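/- Let $D\subset\mathbb C^n$ be a bounded convex domain (nonempty, open), with Euclidean norm $\|\cdot\|$, and $\delta_D(z)=\inf\{\|z-w\|:w\in\mathbb C^n\setminus D\}$. The Kobayashi–Royden metric is $\kappa_D(z;X)=\inf\{|\alpha| : \alpha\in\mathbb C,\ \exists\,\varphi:\mathbb D\to D \text{ holomorphic},\ \varphi(0)=z,\ \alpha\varphi'(0)=X\}$, and the Kobayashi distance $k_D(x,y)$ is the infimum of $\int_0^1\kappa_D(\gamma(t);\gamma'(t))\,dt$ over all piecewise $\mathcal C^1$ curves $\gamma:[0,1]\to D$ from $x$ to $y$. The Gromov product is $(x|y)_o=\frac12[k_D(x,o)+k_D(o,y)-k_D(x,y)]$. A complex face of $D$ is a nonempty set $L\cap\partial D$, where $L$ is an affine complex line with $L\cap D=\emptyset$; the multiface $F_p$ of $p\in\partial D$ is the union of all complex faces containing $p$. We call $F_p$ trivial if $F_p\subseteq\{p\}$. (If $n\ge2$ then always $p\in F_p$, so this means $F_p=\{p\}$; if $n=1$ then $F_p=\emptyset$ for every $p$.) The log-estimate holds at $(p,q)$ if $$\limsup_{(x,y)\to(p,q),\ x,y\in D}\Big(\tfrac12\log\tfrac1{\delta_D(x)}+\tfrac12\log\tfrac1{\delta_D(y)}-k_D(x,y)\Big)<\infty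 .$$ $D$ has $\frac12$-log-growth if $\sup_{z\in D}\big(k_D(x_0,z)-\frac12\log\frac1{\delta_D(z)}\big)<\infty$ for some $x_0\in D$. A geodesic is a map $\sigma:[0,L]\to D$ with $k_D(\sigma(s),\sigma(t))=|s-t|$ for all $s,t\in[0,L]$. $D$ has the visibility property if $k_D$ is a complete distance on $D$ and, for all $p\ne q$ in $\partial D$, there are neighborhoods $U$ of $p$ and $V$ of $q$ with $\overline U\cap\overline V=\emptyset$ and a compact set $K\subset D$ such that every geodesic $\sigma:[0,L]\to D$ with $\sigma(0)\in U$ and $\sigma(L)\in V$ meets $K$. Then: 1. If $p,q\in\partial D$ satisfy $F_p\cap F_q=\emptyset$ (and, in case $n=1$, also $p\neq q$), then the log-estimate holds at $(p,q)$. If moreover $D$ has $\frac12$-log-growth, then $\limsup_{(x,y)\to(p,q),\ x,y\in D}(x|y)_o<\infty$ for every base point $o\in D$. 2. If $p\in\partial D$ has trivial multiface, then the log-estimate holds at $(p,q)$ for every $q\in\partial D\setminus\{p\}$. 3. If $F_p$ is trivial for every $p\in\partial D$ and $D$ has $\frac12$-log-growth, then $D$ has the visibility property. -/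

import Mathlib

open Set Filter Topology MeasureTheory

noncomputable section

namespace ConvexVisibility

/-- The Kobayashi-Royden (pseudo)metric `κ_D(z; X)`, with values in `[0, ∞]`: the infimum of `|α|`
over the `α ∈ ℂ` and the holomorphic `φ : 𝔻 → D` with `φ(0) = z` and `α φ'(0) = X`. -/
def kobayashiMetric {n : ℕ} (D : Set (EuclideanSpace ℂ (Fin n)))
    (z X : EuclideanSpace ℂ (Fin n)) : ENNReal :=
  sInf {r : ENNReal | ∃ (α : ℂ) (φ : ℂ → EuclideanSpace ℂ (Fin n)),
    DifferentiableOn ℂ φ (Metric.ball 0 1) ∧ MapsTo φ (Metric.ball 0 1) D ∧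
    φ 0 = z ∧ α • deriv φ 0 = X ∧ r = ‖α‖ₑ}

/-- `γ : [0,1] → D` is a piecewise `C¹` curve in `D` from `x` to `y`. -/
structure IsPiecewiseC1Curve {n : ℕ} (D : Set (EuclideanSpace ℂ (Fin n)))
    (x y : EuclideanSpace ℂ (Fin n)) (γ : ℝ → EuclideanSpace ℂ (Fin n)) : Prop where
  mapsTo : MapsTo γ (Icc 0 1) D
  source : γ 0 = x
  target : γ 1 = y
  continuousOn : ContinuousOn γ (Icc 0 1)
  piecewise : ∃ (m : ℕ) (t : ℕ → ℝ), Monotone t ∧ t 0 = 0 ∧ t m = 1 ∧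
    ∀ i < m, ContDiffOn ℝ 1 γ (Icc (t i) (t (i + 1)))

/-- The Kobayashi (pseudo)distance with values in `[0, ∞]`: the infimum of
`∫₀¹ κ_D(γ(t); γ'(t)) dt` over the piecewise `C¹` curves in `D` from `x` to `y`. -/
def kobayashiEDist {n : ℕ} (D : Set (EuclideanSpace ℂ (Fin n)))
    (x y : EuclideanSpace ℂ (Fin n)) : ENNReal :=
  sInf {r : ENNReal | ∃ γ : ℝ → EuclideanSpace ℂ (Fin n), IsPiecewiseC1Curve D x y γ ∧
    r = ∫⁻ t in Icc (0 : ℝ) 1, kobayashiMetric D (γ t) (deriv γ t)}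

/-- The Kobayashi (pseudo)distance `k_D(x, y)` as a real number (the infimum above is finite
for points `x, y` of a connected open set `D`). -/
def kobayashiDist {n : ℕ} (D : Set (EuclideanSpace ℂ (Fin n)))
    (x y : EuclideanSpace ℂ (Fin n)) : ℝ :=
  (kobayashiEDist D x y).toReal

/-- `D` is complete hyperbolic: `k_D` is a distance on `D`, and it is complete. -/
def IsCompleteHyperbolic {n : ℕ} (D : Set (EuclideanSpace ℂ (Fin n))) : Prop :=
  (∀ x ∈ D, ∀ y ∈ D, kobayashiDist D x y = 0 → x = y) ∧
  ∀ u : ℕ → EuclideanSpace ℂ (Fin n), (∀ k, u k ∈ D) →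
    (∀ ε > 0, ∃ N, ∀ k ≥ N, ∀ l ≥ N, kobayashiDist D (u k) (u l) < ε) →
    ∃ z ∈ D, Tendsto (fun k => kobayashiDist D (u k) z) atTop (𝓝 0)

/-- `σ : [0,L] → D` is a geodesic for `k_D`. -/
def IsGeodesic {n : ℕ} (D : Set (EuclideanSpace ℂ (Fin n))) (L : ℝ)
    (σ : ℝ → EuclideanSpace ℂ (Fin n)) : Prop :=
  0 ≤ L ∧ MapsTo σ (Icc 0 L) D ∧
    ∀ s ∈ Icc 0 L, ∀ t ∈ Icc 0 L, kobayashiDist D (σ s) (σ t) = |s - t|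

/-- The pair `{p, q}` has visible geodesics. -/
def HasVisibleGeodesics {n : ℕ} (D : Set (EuclideanSpace ℂ (Fin n)))
    (p q : EuclideanSpace ℂ (Fin n)) : Prop :=
  ∃ U ∈ 𝓝 p, ∃ V ∈ 𝓝 q, closure U ∩ closure V = ∅ ∧
    ∃ K ⊆ D, IsCompact K ∧
      ∀ (L : ℝ) (σ : ℝ → EuclideanSpace ℂ (Fin n)), IsGeodesic D L σ →
        σ 0 ∈ U → σ L ∈ V → (σ '' Icc 0 L ∩ K).Nonempty

/-- `D` has the visibility property (a notion for complete hyperbolic domains). -/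
def HasVisibilityProperty {n : ℕ} (D : Set (EuclideanSpace ℂ (Fin n))) : Prop :=
  IsCompleteHyperbolic D ∧
    ∀ p ∈ frontier D, ∀ q ∈ frontier D, p ≠ q → HasVisibleGeodesics D p q

/-- The Gromov product `(x|y)_o`. -/
def gromovProduct {n : ℕ} (D : Set (EuclideanSpace ℂ (Fin n)))
    (o x y : EuclideanSpace ℂ (Fin n)) : ℝ :=
  (1 / 2) * (kobayashiDist D x o + kobayashiDist D o y - kobayashiDist D x y)

/-- `limsup_{(x,y) → (p,q)} (x|y)_o < ∞`, where `x, y` range over `D`. -/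
def GromovProductBounded {n : ℕ} (D : Set (EuclideanSpace ℂ (Fin n)))
    (o p q : EuclideanSpace ℂ (Fin n)) : Prop :=
  limsup (fun z : EuclideanSpace ℂ (Fin n) × EuclideanSpace ℂ (Fin n) =>
    ((gromovProduct D o z.1 z.2 : ℝ) : EReal)) (𝓝[D] p ×ˢ 𝓝[D] q) < ⊤

/-- `δ_D(z)`, the Euclidean distance of `z` from the complement of `D`. -/
def boundaryDist {n : ℕ} (D : Set (EuclideanSpace ℂ (Fin n)))
    (z : EuclideanSpace ℂ (Fin n)) : ℝ :=
  Metric.infDist z Dᶜ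

/-- The log-estimate at `(p, q)`:
`limsup_{(x,y) → (p,q)} (½ log (1/δ_D(x)) + ½ log (1/δ_D(y)) - k_D(x,y)) < ∞`,
where `x, y` range over `D`. -/
def LogEstimate {n : ℕ} (D : Set (EuclideanSpace ℂ (Fin n)))
    (p q : EuclideanSpace ℂ (Fin n)) : Prop :=
  limsup (fun z : EuclideanSpace ℂ (Fin n) × EuclideanSpace ℂ (Fin n) =>
    (((1 / 2) * Real.log (1 / boundaryDist D z.1) + (1 / 2) * Real.log (1 / boundaryDist D z.2)
      - kobayashiDist D z.1 z.2 : ℝ) : EReal)) (𝓝[D] p ×ˢ 𝓝[D] q) < ⊤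

/-- `D` has `α`-log-growth. -/
def HasLogGrowth {n : ℕ} (D : Set (EuclideanSpace ℂ (Fin n))) (α : ℝ) : Prop :=
  0 < α ∧ ∃ x₀ ∈ D,
    BddAbove ((fun z => kobayashiDist D x₀ z - α * Real.log (1 / boundaryDist D z)) '' D)

/-- `F` is a complex face of `D`: `F = L ∩ ∂D` is nonempty, where `L` is an affine complex line
that does not meet `D`. -/
def IsComplexFace {n : ℕ} (D F : Set (EuclideanSpace ℂ (Fin n))) : Prop :=
  ∃ L : AffineSubspace ℂ (EuclideanSpace ℂ (Fin n)), Module.finrank ℂ L.direction = 1 ∧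
    (L : Set (EuclideanSpace ℂ (Fin n))) ∩ D = ∅ ∧
    ((L : Set (EuclideanSpace ℂ (Fin n))) ∩ frontier D).Nonempty ∧
    F = (L : Set (EuclideanSpace ℂ (Fin n))) ∩ frontier D

/-- The multiface `F_p`: the union of the complex faces of `D` that contain `p`. -/
def multiface {n : ℕ} (D : Set (EuclideanSpace ℂ (Fin n)))
    (p : EuclideanSpace ℂ (Fin n)) : Set (EuclideanSpace ℂ (Fin n)) :=
  ⋃₀ {F | IsComplexFace D F ∧ p ∈ F}

end ConvexVisibility

end

/-! For `w ∉ D`, convexity gives a unit vector `v` such that `ℓ(z) = ⟨v, w - z⟩`, holomorphic in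
`z`, maps `D` into the right half-plane. By the Schwarz lemma, `κ_D(z; X) ≥ |⟨v, X⟩| / (2|ℓ(z)|)`,
so a curve costs at least half the variation of `log |ℓ|` between its ends. If `w` is a boundary
point nearest to `x`, then `|ℓ(x)| ≤ δ_D(x)`: leaving the region `|ℓ| < c` from `x` costs at least
`½ log (1/δ_D(x))` up to a constant.

Suppose no supporting functionals at `p` and at `q` have a common zero in the closure of `D`. By
compactness, functionals at points near `p` and `q` are never both smaller than some `c > 0` on `D`
(`exists_pos_le_norm_inner_or`). Every curve from near `p` to near `q` then has a point where both
are at least `c`, and the two costs add up (`ofReal_log_add_log_le_kobayashiEDist`). This is the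
log-estimate (`logEstimate_of_separated`).

The conditions on multiface exclude common zeros: a complex line on which a supporting functional
vanishes misses `D`, so two zeros of one functional in the closure share a complex face. For
visibility, geodesics escaping to the boundary would contain points tending to some `r ≠ p, q` in
the frontier. The log-estimates at `(p, r)` and `(r, q)` then add a term `log (1/δ_D)` at these
points, which ½-log-growth forbids. -/

namespace ConvexVisibility

variable {n : ℕ}

/-! ### Supporting functionals of a convex domain -/

/-- `v` is a unit vector that defines a real supporting hyperplane of `D` through `w`. -/
def IsSupportVector (D : Set (EuclideanSpace ℂ (Fin n))) (w v : EuclideanSpace ℂ (Fin n)) : Prop :=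
  ‖v‖ = 1 ∧ ∀ z ∈ D, 0 ≤ (inner ℂ v (w - z)).re

theorem exists_isSupportVector {D : Set (EuclideanSpace ℂ (Fin n))} (hne : D.Nonempty)
    (hopen : IsOpen D) (hconv : Convex ℝ D) {w : EuclideanSpace ℂ (Fin n)} (hw : w ∉ D) :
    ∃ v, IsSupportVector D w v := by
  obtain ⟨f, hf⟩ := RCLike.geometric_hahn_banach_open_point (𝕜 := ℂ) hconv hopen hw
  set v₀ := (InnerProductSpace.toDual ℂ (EuclideanSpace ℂ (Fin n))).symm f with hv₀
  have hin : ∀ z, inner ℂ v₀ z = f z := fun z => by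
    rw [hv₀, InnerProductSpace.toDual_symm_apply]
  -- A point of `D` rules out the zero functional, since the separation is strict.
  have hne0 : v₀ ≠ 0 := by
    obtain ⟨a, ha⟩ := hne
    intro h0
    have := hf a ha
    simp [← hin, h0] at this
  refine ⟨((‖v₀‖⁻¹ : ℝ) : ℂ) • v₀, ?_, fun z hz => ?_⟩
  · rw [norm_smul, Complex.norm_real, norm_inv, norm_norm,
      inv_mul_cancel₀ (norm_ne_zero_iff.2 hne0)]
  · rw [inner_smul_left, Complex.conj_ofReal, Complex.re_ofReal_mul, hin, map_sub, Complex.sub_re]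
    have := hf z hz
    simp only [RCLike.re_to_complex] at this
    exact mul_nonneg (by positivity) (by linarith)

/-- Moving from `z` by `t < r` in the direction `v` stays in `D` and lowers `Re ℓ` by exactly `t`.
-/
theorem IsSupportVector.le_re_inner {D : Set (EuclideanSpace ℂ (Fin n))}
    {w v z : EuclideanSpace ℂ (Fin n)} (h : IsSupportVector D w v) {r : ℝ} (hr0 : 0 < r)
    (hr : Metric.ball z r ⊆ D) : r ≤ (inner ℂ v (w - z)).re := by
  refine le_of_forall_lt_imp_le_of_dense fun t ht => ?_
  by_cases ht0 : t ≤ 0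
  · exact ht0.trans (h.2 z (hr (Metric.mem_ball_self hr0)))
  push Not at ht0
  have hmem : z + (t : ℂ) • v ∈ Metric.ball z r := by
    simpa [mem_ball_iff_norm, norm_smul, h.1, abs_of_pos ht0] using ht
  have := h.2 _ (hr hmem)
  rw [← sub_sub, inner_sub_right, inner_smul_right, inner_self_eq_norm_sq_to_K, h.1] at this
  simp only [Complex.sub_re] at this
  simp at this
  exact this

theorem IsSupportVector.re_inner_pos {D : Set (EuclideanSpace ℂ (Fin n))} (hopen : IsOpen D)
    {w v z : EuclideanSpace ℂ (Fin n)} (h : IsSupportVector D w v) (hz : z ∈ D) :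
    0 < (inner ℂ v (w - z)).re := by
  obtain ⟨r, hr, hball⟩ := Metric.isOpen_iff.1 hopen z hz
  exact hr.trans_le (h.le_re_inner hr hball)

theorem IsSupportVector.norm_inner_le {D : Set (EuclideanSpace ℂ (Fin n))}
    {w v : EuclideanSpace ℂ (Fin n)} (h : IsSupportVector D w v) (z : EuclideanSpace ℂ (Fin n)) :
    ‖inner ℂ v (w - z)‖ ≤ ‖w - z‖ := by
  simpa only [h.1, one_mul] using norm_inner_le_norm (𝕜 := ℂ) v (w - z)

/-! ### Pointwise bounds for the Kobayashi metric -/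

/-- The Schwarz lemma at the center of the disc for maps into the right half-plane. -/
theorem norm_deriv_le_of_re_pos {h : ℂ → ℂ} (hd : DifferentiableOn ℂ h (Metric.ball 0 1))
    (hpos : ∀ ζ ∈ Metric.ball (0 : ℂ) 1, 0 < (h ζ).re) : ‖deriv h 0‖ ≤ 2 * (h 0).re := by
  have h0 : (0 : ℂ) ∈ Metric.ball (0 : ℂ) 1 := by simp
  set a := h 0 with ha
  have hapos : 0 < a.re := hpos 0 h0
  have hden : ∀ u : ℂ, 0 < u.re → u + (starRingEnd ℂ) a ≠ 0 := fun u hu he => by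
    have := congrArg Complex.re he
    simp at this
    linarith
  have hda : HasDerivAt h (deriv h 0) 0 :=
    (hd.differentiableAt (Metric.isOpen_ball.mem_nhds h0)).hasDerivAt
  -- Cayley transform of the half-plane onto the disc sending `a` to `0`; its derivative at `a` is
  -- `1 / (2 Re a)`.
  set g : ℂ → ℂ := fun ζ => (h ζ - a) / (h ζ + (starRingEnd ℂ) a) with hg
  have hgd : DifferentiableOn ℂ g (Metric.ball 0 1) :=
    (hd.sub_const a).div (hd.add_const _) fun ζ hζ => hden _ (hpos ζ hζ)
  have hg0 : g 0 = 0 := by simp [hg, ha]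
  have hmaps : MapsTo g (Metric.ball 0 1) (Metric.closedBall (g 0) 1) := fun ζ hζ => by
    have hu := hpos ζ hζ
    rw [hg0, mem_closedBall_zero_iff, hg]
    simp only [norm_div]
    rw [div_le_one (norm_pos_iff.2 (hden _ hu)), ← sq_le_sq₀ (norm_nonneg _) (norm_nonneg _),
      Complex.sq_norm, Complex.sq_norm, Complex.normSq_apply, Complex.normSq_apply]
    simp only [Complex.sub_re, Complex.sub_im, Complex.add_re, Complex.add_im, Complex.conj_re,
      Complex.conj_im]
    nlinarith [mul_pos hu hapos]
  have hgder : HasDerivAt g (deriv h 0 / (2 * a.re : ℝ)) 0 := by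
    have := (hda.sub_const a).div (hda.add_const ((starRingEnd ℂ) a)) (hden _ hapos)
    have hc : a + (starRingEnd ℂ) a = (2 * a.re : ℝ) := Complex.add_conj a
    rw [← ha, hc, sub_self, zero_mul, sub_zero, sq, mul_div_mul_right] at this
    · exact this
    · exact_mod_cast (by positivity : (2 * a.re) ≠ 0)
  have := Complex.norm_deriv_le_one_of_mapsTo_ball hgd hmaps one_pos
  rw [hgder.deriv, norm_div, Complex.norm_real, Real.norm_of_nonneg (by positivity),
    div_le_one (by positivity)] at this
  exact this

/-- Composing a competing disc with `ℓ` gives a map into the right half-plane. Weakening `Re ℓ` to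
`ℓ` in the denominator leaves half the logarithmic derivative of `ℓ`, which integrates along curves.
-/
theorem IsSupportVector.enorm_inner_div_le_kobayashiMetric {D : Set (EuclideanSpace ℂ (Fin n))}
    (hopen : IsOpen D) {w v : EuclideanSpace ℂ (Fin n)} (h : IsSupportVector D w v)
    {z : EuclideanSpace ℂ (Fin n)} (hz : z ∈ D) (X : EuclideanSpace ℂ (Fin n)) :
    ‖inner ℂ v X / (2 * inner ℂ v (w - z))‖ₑ ≤ kobayashiMetric D z X := by
  refine le_sInf ?_
  rintro _ ⟨α, φ, hφ, hmaps, h0, hX, rfl⟩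
  have hmem : (0 : ℂ) ∈ Metric.ball (0 : ℂ) 1 := by simp
  have hφ0 : HasDerivAt φ (deriv φ 0) 0 :=
    (hφ.differentiableAt (Metric.isOpen_ball.mem_nhds hmem)).hasDerivAt
  have hder : HasDerivAt (fun ζ => inner ℂ v (w - φ ζ)) (-inner ℂ v (deriv φ 0)) 0 := by
    have := (innerSL ℂ v).hasFDerivAt.comp_hasDerivAt (0 : ℂ) (hφ0.const_sub w)
    simpa only [Function.comp_def, innerSL_apply_apply, inner_neg_right] using this
  have hdiff : DifferentiableOn ℂ (fun ζ => inner ℂ v (w - φ ζ)) (Metric.ball 0 1) :=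
    (innerSL ℂ v).differentiable.comp_differentiableOn (hφ.const_sub w)
  have key := norm_deriv_le_of_re_pos hdiff fun ζ hζ => h.re_inner_pos hopen (hmaps hζ)
  rw [hder.deriv, norm_neg, h0] at key
  have hpos := h.re_inner_pos hopen hz
  have hle := Complex.re_le_norm (inner ℂ v (w - z))
  rw [enorm_le_iff_norm_le, ← hX, inner_smul_right, norm_div, norm_mul, norm_mul,
    div_le_iff₀ (mul_pos (by simp) (hpos.trans_le hle)), Complex.norm_two]
  exact mul_le_mul_of_nonneg_left (by linarith) (norm_nonneg _)

theorem enorm_le_mul_kobayashiMetric {D : Set (EuclideanSpace ℂ (Fin n))} {R : ℝ} (hR : 0 < R)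
    (hD : ∀ x ∈ D, ∀ y ∈ D, dist x y ≤ R) (z X : EuclideanSpace ℂ (Fin n)) :
    ‖X‖ₑ ≤ ENNReal.ofReal R * kobayashiMetric D z X := by
  have hR' : ENNReal.ofReal R ≠ 0 := by simpa using hR
  rw [mul_comm, ← ENNReal.div_le_iff hR' ENNReal.ofReal_ne_top]
  refine le_sInf ?_
  rintro _ ⟨α, φ, hφ, hmaps, h0, hX, rfl⟩
  have hmem : (0 : ℂ) ∈ Metric.ball (0 : ℂ) 1 := by simp
  have := Complex.norm_deriv_le_div_of_mapsTo_ball hφ (R₂ := R)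
    (fun ζ hζ => hD _ (hmaps hζ) _ (hmaps hmem)) one_pos
  rw [ENNReal.div_le_iff hR' ENNReal.ofReal_ne_top, ← hX, enorm_smul]
  gcongr
  rw [← ofReal_norm]
  exact ENNReal.ofReal_le_ofReal (by simpa using this)

theorem kobayashiMetric_le {D : Set (EuclideanSpace ℂ (Fin n))} {z : EuclideanSpace ℂ (Fin n)}
    {r : ℝ} (hr : 0 < r) (hball : Metric.ball z r ⊆ D) (X : EuclideanSpace ℂ (Fin n)) :
    kobayashiMetric D z X ≤ ENNReal.ofReal (‖X‖ / r) := by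
  refine sInf_le ?_
  have hder : ∀ Y : EuclideanSpace ℂ (Fin n), HasDerivAt (fun ζ : ℂ => z + ζ • Y) Y 0 := fun Y => by
    simpa using ((hasDerivAt_id (0 : ℂ)).smul_const Y).const_add z
  -- The affine disc below divides by `‖X‖`; a zero vector needs a constant disc instead.
  by_cases hX : X = 0
  · refine ⟨0, fun _ => z, differentiableOn_const _, fun _ _ => hball (by simpa), rfl, ?_, ?_⟩ <;>
      simp [hX]
  have hX' : 0 < ‖X‖ := norm_pos_iff.2 hX
  refine ⟨((‖X‖ / r : ℝ) : ℂ), fun ζ => z + ζ • (((r / ‖X‖ : ℝ) : ℂ) • X), by fun_prop,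
    fun ζ hζ => hball ?_, by simp, ?_, ?_⟩
  · rw [mem_ball_zero_iff] at hζ
    rw [mem_ball_iff_norm, add_sub_cancel_left, norm_smul, norm_smul, Complex.norm_real, norm_div,
      norm_norm, Real.norm_of_nonneg hr.le, div_mul_cancel₀ _ hX'.ne']
    nlinarith
  · rw [(hder _).deriv, smul_smul, ← Complex.ofReal_mul, div_mul_div_cancel₀ hr.ne', div_self hX'.ne']
    simp
  · rw [← ofReal_norm, Complex.norm_real, Real.norm_of_nonneg (by positivity)]

theorem kobayashiMetric_smul_le (D : Set (EuclideanSpace ℂ (Fin n)))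
    (z X : EuclideanSpace ℂ (Fin n)) {c : ℝ} (hc : c ≠ 0) :
    kobayashiMetric D z (c • X) ≤ ‖c‖ₑ * kobayashiMetric D z X := by
  have hc0 : ‖c‖ₑ ≠ 0 := by simpa using hc
  rw [mul_comm, ← ENNReal.div_le_iff hc0 enorm_ne_top]
  refine le_sInf ?_
  rintro _ ⟨α, φ, hφ, hmaps, h0, hX, rfl⟩
  rw [ENNReal.div_le_iff hc0 enorm_ne_top]
  refine sInf_le ⟨α * c, φ, hφ, hmaps, h0, ?_, ?_⟩
  · rw [mul_comm, mul_smul, hX, Complex.coe_smul]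
  · rw [enorm_mul]
    congr 1
    simp [← ofReal_norm]

/-! ### Lower bounds for lengths of curves and for the distance -/

/-- Integrability of the derivative need not be assumed: if it fails, the right side is `∞`. -/
theorem enorm_sub_le_lintegral_deriv_off_countable {E : Type*} [NormedAddCommGroup E]
    [NormedSpace ℝ E] [CompleteSpace E] {f : ℝ → E} {a b : ℝ} (hab : a ≤ b) {s : Set ℝ}
    (hs : s.Countable) (hf : ContinuousOn f (Icc a b))
    (hd : ∀ t ∈ Ioo a b \ s, DifferentiableAt ℝ f t) :
    ‖f b - f a‖ₑ ≤ ∫⁻ t in Icc a b, ‖deriv f t‖ₑ := by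
  by_cases htop : ∫⁻ t in Icc a b, ‖deriv f t‖ₑ = ⊤
  · simp [htop]
  have hint : IntegrableOn (deriv f) (Icc a b) :=
    ⟨(stronglyMeasurable_deriv f).aestronglyMeasurable, lt_top_iff_ne_top.2 htop⟩
  rw [← MeasureTheory.integral_eq_of_hasDerivAt_off_countable_of_le f (deriv f) hab hs hf
    (fun t ht => (hd t ht).hasDerivAt)
    ((intervalIntegrable_iff_integrableOn_Icc_of_le hab).2 hint),
    intervalIntegral.integral_of_le hab, ← integral_Icc_eq_integral_Ioc]
  exact enorm_integral_le_lintegral_enorm _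

theorem exists_mem_Ico_of_monotone {t : ℕ → ℝ} {m : ℕ} {s : ℝ} (hs : s ∈ Ico (t 0) (t m)) :
    ∃ i < m, s ∈ Ico (t i) (t (i + 1)) := by
  induction m with
  | zero => exact absurd hs (by simp)
  | succ m ih =>
    by_cases h : s < t m
    · obtain ⟨i, hi, hmem⟩ := ih ⟨hs.1, h⟩
      exact ⟨i, hi.trans m.lt_succ_self, hmem⟩
    · exact ⟨m, m.lt_succ_self, not_lt.1 h, hs.2⟩

theorem IsPiecewiseC1Curve.exists_countable {D : Set (EuclideanSpace ℂ (Fin n))}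
    {x y : EuclideanSpace ℂ (Fin n)} {γ : ℝ → EuclideanSpace ℂ (Fin n)}
    (h : IsPiecewiseC1Curve D x y γ) :
    ∃ s : Set ℝ, s.Countable ∧ ∀ t ∈ Ioo (0 : ℝ) 1 \ s, DifferentiableAt ℝ γ t := by
  obtain ⟨m, τ, -, h0, h1, hd⟩ := h.piecewise
  refine ⟨range τ, countable_range τ, fun t ht => ?_⟩
  obtain ⟨i, hi, hmem⟩ := exists_mem_Ico_of_monotone (t := τ) (m := m) (s := t)
    ⟨h0 ▸ ht.1.1.le, h1 ▸ ht.1.2⟩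
  have hlt : τ i < t := lt_of_le_of_ne hmem.1 fun he => ht.2 ⟨i, he⟩
  exact ((hd i hi).differentiableOn one_ne_zero).differentiableAt (Icc_mem_nhds hlt hmem.2)

/-- Common source of all length bounds, used with `G = log ℓ` and `G = id`. The chain rule is
assumed along real curves only, so no differential of `G` is needed. -/
theorem IsPiecewiseC1Curve.enorm_comp_sub_le {F : Type*} [NormedAddCommGroup F] [NormedSpace ℝ F]
    [CompleteSpace F]
    {D : Set (EuclideanSpace ℂ (Fin n))}
    {x y : EuclideanSpace ℂ (Fin n)} {γ : ℝ → EuclideanSpace ℂ (Fin n)}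
    (h : IsPiecewiseC1Curve D x y γ) {G : EuclideanSpace ℂ (Fin n) → F}
    {G' : EuclideanSpace ℂ (Fin n) → EuclideanSpace ℂ (Fin n) → F} (hGc : ContinuousOn G D)
    (hG : ∀ (γ : ℝ → EuclideanSpace ℂ (Fin n)) t X, γ t ∈ D → HasDerivAt γ X t →
      HasDerivAt (fun s => G (γ s)) (G' (γ t) X) t)
    {k : EuclideanSpace ℂ (Fin n) → EuclideanSpace ℂ (Fin n) → ENNReal}
    (hk : ∀ z ∈ D, ∀ X, ‖G' z X‖ₑ ≤ k z X)
    {a b : ℝ} (ha : 0 ≤ a) (hab : a ≤ b) (hb : b ≤ 1) :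
    ‖G (γ b) - G (γ a)‖ₑ ≤ ∫⁻ t in Icc a b, k (γ t) (deriv γ t) := by
  obtain ⟨s, hs, hd⟩ := h.exists_countable
  have hsub : Icc a b ⊆ Icc 0 1 := Icc_subset_Icc ha hb
  have hder : ∀ t ∈ Ioo a b \ s, HasDerivAt (fun s => G (γ s)) (G' (γ t) (deriv γ t)) t := fun t ht =>
    hG γ t _ (h.mapsTo (hsub (Ioo_subset_Icc_self ht.1)))
      (hd t ⟨Ioo_subset_Ioo ha hb ht.1, ht.2⟩).hasDerivAt
  refine (enorm_sub_le_lintegral_deriv_off_countable (f := fun s => G (γ s)) hab hs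
    (hGc.comp (h.continuousOn.mono hsub) fun t ht => h.mapsTo (hsub ht))
    fun t ht => (hder t ht).differentiableAt).trans ?_
  -- The endpoints are dropped because differentiability is known only inside the interval.
  rw [setLIntegral_congr Ioo_ae_eq_Icc.symm, setLIntegral_congr Ioo_ae_eq_Icc.symm]
  refine lintegral_mono_ae ?_
  have hs0 : ∀ᵐ t ∂(volume.restrict (Ioo a b)), t ∉ s :=
    ae_restrict_of_ae (hs.ae_notMem volume)
  filter_upwards [hs0, ae_restrict_mem measurableSet_Ioo] with t hts ht
  rw [(hder t ⟨ht, hts⟩).deriv]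
  exact hk _ (h.mapsTo (hsub (Ioo_subset_Icc_self ht))) _

theorem IsSupportVector.enorm_log_sub_le {D : Set (EuclideanSpace ℂ (Fin n))} (hopen : IsOpen D)
    {w v : EuclideanSpace ℂ (Fin n)} (hv : IsSupportVector D w v)
    {x y : EuclideanSpace ℂ (Fin n)} {γ : ℝ → EuclideanSpace ℂ (Fin n)}
    (h : IsPiecewiseC1Curve D x y γ) {a b : ℝ} (ha : 0 ≤ a) (hab : a ≤ b) (hb : b ≤ 1) :
    ‖Complex.log (inner ℂ v (w - γ b)) - Complex.log (inner ℂ v (w - γ a))‖ₑ ≤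
      2 * ∫⁻ t in Icc a b, kobayashiMetric D (γ t) (deriv γ t) := by
  rw [← lintegral_const_mul' _ _ ENNReal.ofNat_ne_top]
  refine h.enorm_comp_sub_le (G := fun z => Complex.log (inner ℂ v (w - z)))
    (G' := fun z X => -inner ℂ v X / inner ℂ v (w - z)) (k := fun z X => 2 * kobayashiMetric D z X)
    (ContinuousOn.clog (by fun_prop) fun z hz => Or.inl (hv.re_inner_pos hopen hz))
    (fun γ t X ht hγ => ?_) (fun z hz X => ?_) ha hab hb
  · refine HasDerivAt.clog_real (f := fun s => inner ℂ v (w - γ s)) ?_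
      (Or.inl (hv.re_inner_pos hopen ht))
    have := ((innerSL ℂ v).restrictScalars ℝ).hasFDerivAt.comp_hasDerivAt t (hγ.const_sub w)
    rw [← inner_neg_right]
    exact this
  have key := hv.enorm_inner_div_le_kobayashiMetric hopen hz X
  have heq : -inner ℂ v X / inner ℂ v (w - z) = -2 * (inner ℂ v X / (2 * inner ℂ v (w - z))) := by
    rw [div_eq_mul_inv, div_eq_mul_inv, mul_inv]
    ring
  rw [heq, enorm_mul, enorm_neg]
  refine mul_le_mul' (le_of_eq ?_) key
  rw [← ofReal_norm]
  simp

/-- The real part of `log ℓ` is `log |ℓ|`. -/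
theorem IsSupportVector.abs_log_sub_le {D : Set (EuclideanSpace ℂ (Fin n))} (hopen : IsOpen D)
    {w v : EuclideanSpace ℂ (Fin n)} (hv : IsSupportVector D w v)
    {x y : EuclideanSpace ℂ (Fin n)} {γ : ℝ → EuclideanSpace ℂ (Fin n)}
    (h : IsPiecewiseC1Curve D x y γ) {a b : ℝ} (ha : 0 ≤ a) (hab : a ≤ b) (hb : b ≤ 1) :
    ENNReal.ofReal (1 / 2 * |Real.log ‖inner ℂ v (w - γ b)‖ - Real.log ‖inner ℂ v (w - γ a)‖|) ≤
      ∫⁻ t in Icc a b, kobayashiMetric D (γ t) (deriv γ t) := by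
  have key := hv.enorm_log_sub_le hopen h ha hab hb
  rw [← ENNReal.div_le_iff' (by simp) (by simp)] at key
  refine le_trans ?_ key
  have := Complex.abs_re_le_norm
    (Complex.log (inner ℂ v (w - γ b)) - Complex.log (inner ℂ v (w - γ a)))
  rw [Complex.sub_re, Complex.log_re, Complex.log_re] at this
  generalize Real.log ‖inner ℂ v (w - γ b)‖ - Real.log ‖inner ℂ v (w - γ a)‖ = r at this ⊢
  generalize Complex.log (inner ℂ v (w - γ b)) - Complex.log (inner ℂ v (w - γ a)) = c at this ⊢
  rw [ENNReal.le_div_iff_mul_le (by simp) (by simp), ← ofReal_norm, ← ENNReal.ofReal_ofNat 2,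
    ← ENNReal.ofReal_mul (by positivity)]
  exact ENNReal.ofReal_le_ofReal (by linarith)

theorem IsPiecewiseC1Curve.enorm_sub_le {D : Set (EuclideanSpace ℂ (Fin n))} {R : ℝ} (hR : 0 < R)
    (hD : ∀ x ∈ D, ∀ y ∈ D, dist x y ≤ R)
    {x y : EuclideanSpace ℂ (Fin n)} {γ : ℝ → EuclideanSpace ℂ (Fin n)}
    (h : IsPiecewiseC1Curve D x y γ) :
    ‖y - x‖ₑ ≤ ENNReal.ofReal R * ∫⁻ t in Icc 0 1, kobayashiMetric D (γ t) (deriv γ t) := by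
  rw [← lintegral_const_mul' _ _ ENNReal.ofReal_ne_top, ← h.source, ← h.target]
  exact h.enorm_comp_sub_le (G := id) (G' := fun _ X => X)
    (k := fun z X => ENNReal.ofReal R * kobayashiMetric D z X) continuousOn_id
    (fun _ _ _ _ h => h)
    (fun z _ X => enorm_le_mul_kobayashiMetric hR hD z X) le_rfl zero_le_one le_rfl

theorem enorm_sub_le_kobayashiEDist {D : Set (EuclideanSpace ℂ (Fin n))} {R : ℝ} (hR : 0 < R)
    (hD : ∀ x ∈ D, ∀ y ∈ D, dist x y ≤ R) (x y : EuclideanSpace ℂ (Fin n)) :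
    ‖y - x‖ₑ ≤ ENNReal.ofReal R * kobayashiEDist D x y := by
  have hR' : ENNReal.ofReal R ≠ 0 := by simpa using hR
  rw [mul_comm, ← ENNReal.div_le_iff hR' ENNReal.ofReal_ne_top]
  refine le_sInf ?_
  rintro _ ⟨γ, hγ, rfl⟩
  rw [ENNReal.div_le_iff hR' ENNReal.ofReal_ne_top, mul_comm]
  exact hγ.enorm_sub_le hR hD

theorem IsSupportVector.abs_log_sub_le_kobayashiEDist {D : Set (EuclideanSpace ℂ (Fin n))}
    (hopen : IsOpen D) {w v : EuclideanSpace ℂ (Fin n)} (hv : IsSupportVector D w v)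
    (x y : EuclideanSpace ℂ (Fin n)) :
    ENNReal.ofReal (1 / 2 * |Real.log ‖inner ℂ v (w - y)‖ - Real.log ‖inner ℂ v (w - x)‖|) ≤
      kobayashiEDist D x y := by
  refine le_sInf ?_
  rintro _ ⟨γ, hγ, rfl⟩
  simpa only [hγ.source, hγ.target] using hv.abs_log_sub_le hopen hγ le_rfl zero_le_one le_rfl

/-- If the moduli of two supporting functionals are never both smaller than `c` on `D`, then every
curve from a point close to the zero set of the first to a point close to the zero set of the
second has a point where both are at least `c`, so the two lower bounds for its length add up. -/
theorem ofReal_log_add_log_le_kobayashiEDist {D : Set (EuclideanSpace ℂ (Fin n))}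
    (hopen : IsOpen D) {w v w' v' : EuclideanSpace ℂ (Fin n)} (hv : IsSupportVector D w v)
    (hv' : IsSupportVector D w' v') {c : ℝ} (hc : 0 < c)
    (hsep : ∀ z ∈ D, c ≤ ‖inner ℂ v (w - z)‖ ∨ c ≤ ‖inner ℂ v' (w' - z)‖)
    {x y : EuclideanSpace ℂ (Fin n)} (hx : x ∈ D) (hy : y ∈ D)
    (hxc : ‖inner ℂ v (w - x)‖ < c) (hyc : ‖inner ℂ v' (w' - y)‖ < c) :
    ENNReal.ofReal (1 / 2 * (Real.log c - Real.log ‖inner ℂ v (w - x)‖) +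
      1 / 2 * (Real.log c - Real.log ‖inner ℂ v' (w' - y)‖)) ≤ kobayashiEDist D x y := by
  refine le_sInf ?_
  rintro _ ⟨γ, hγ, rfl⟩
  have hcont : ∀ u p : EuclideanSpace ℂ (Fin n), ContinuousOn (fun t => ‖inner ℂ u (p - γ t)‖)
      (Icc 0 1) := fun u p =>
    ((innerSL ℂ u).continuous.comp_continuousOn (continuousOn_const.sub hγ.continuousOn)).norm
  obtain ⟨t, ht, htc, htc'⟩ : ∃ t ∈ Icc (0 : ℝ) 1, c ≤ ‖inner ℂ v (w - γ t)‖ ∧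
      c ≤ ‖inner ℂ v' (w' - γ t)‖ := by
    have hcl : ∀ u p : EuclideanSpace ℂ (Fin n),
        IsClosed (Icc (0 : ℝ) 1 ∩ (fun t => ‖inner ℂ u (p - γ t)‖) ⁻¹' Ici c) := fun u p =>
      (hcont u p).preimage_isClosed_of_isClosed isClosed_Icc isClosed_Ici
    -- The two closed conditions cover the connected interval; the first holds at `1` and the second
    -- at `0`, so they meet.
    obtain ⟨t, ht, h1, h2⟩ := isPreconnected_closed_iff.1
      (isPreconnected_Icc (a := (0 : ℝ)) (b := 1))
      _ _ (hcl v w) (hcl v' w')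
      (fun t ht => (hsep _ (hγ.mapsTo ht)).imp (fun h => ⟨ht, h⟩) fun h => ⟨ht, h⟩)
      ⟨1, by simp, by simp, (hsep _ (hγ.mapsTo (by simp))).resolve_right
        (by rw [hγ.target]; exact not_le.2 hyc)⟩
      ⟨0, by simp, by simp, (hsep _ (hγ.mapsTo (by simp))).resolve_left
        (by rw [hγ.source]; exact not_le.2 hxc)⟩
    exact ⟨t, ht, h1.2, h2.2⟩
  have hpos := (hv.re_inner_pos hopen hx).trans_le (Complex.re_le_norm _)
  have hpos' := (hv'.re_inner_pos hopen hy).trans_le (Complex.re_le_norm _)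
  have h1 := hv.abs_log_sub_le hopen hγ le_rfl ht.1 ht.2
  have h2 := hv'.abs_log_sub_le hopen hγ ht.1 ht.2 le_rfl
  rw [hγ.source] at h1
  rw [hγ.target] at h2
  have hsplit : ∫⁻ s in Icc 0 1, kobayashiMetric D (γ s) (deriv γ s) =
      (∫⁻ s in Icc 0 t, kobayashiMetric D (γ s) (deriv γ s)) +
        ∫⁻ s in Icc t 1, kobayashiMetric D (γ s) (deriv γ s) := by
    rw [← Icc_union_Ioc_eq_Icc ht.1 ht.2, lintegral_union measurableSet_Ioc,
      setLIntegral_congr Ioc_ae_eq_Icc]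
    exact disjoint_left.2 fun s hs hs' => absurd hs.2 (not_le.2 hs'.1)
  rw [hsplit]
  refine le_trans ?_ (add_le_add h1 h2)
  rw [← ENNReal.ofReal_add (by positivity) (by positivity)]
  refine ENNReal.ofReal_le_ofReal (add_le_add ?_ ?_)
  · have := Real.log_le_log hc htc
    have := le_abs_self (Real.log ‖inner ℂ v (w - γ t)‖ - Real.log ‖inner ℂ v (w - x)‖)
    linarith
  · have := Real.log_le_log hc htc'
    have := neg_le_abs (Real.log ‖inner ℂ v' (w' - y)‖ - Real.log ‖inner ℂ v' (w' - γ t)‖)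
    linarith

/-! ### Segments: upper bounds and finiteness -/

theorem isPiecewiseC1Curve_lineMap {D : Set (EuclideanSpace ℂ (Fin n))} (hconv : Convex ℝ D)
    {x y : EuclideanSpace ℂ (Fin n)} (hx : x ∈ D) (hy : y ∈ D) :
    IsPiecewiseC1Curve D x y (fun t : ℝ => x + t • (y - x)) where
  mapsTo t ht := hconv.add_smul_sub_mem hx hy ht
  source := by simp
  target := by simp
  continuousOn := by fun_prop
  piecewise := ⟨1, fun i => i, Nat.mono_cast, by simp, by simp, fun i _ =>
    (contDiff_const.add (contDiff_id.smul contDiff_const)).contDiffOn⟩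

/-- Translate the whole segment by the offset `u` of the given point from the center; the translated
endpoints lie in the two balls. -/
theorem ball_subset_of_mem_segment {D : Set (EuclideanSpace ℂ (Fin n))} (hconv : Convex ℝ D)
    {x y : EuclideanSpace ℂ (Fin n)} {r : ℝ} (hx : Metric.ball x r ⊆ D) (hy : Metric.ball y r ⊆ D)
    {t : ℝ} (ht : t ∈ Icc (0 : ℝ) 1) : Metric.ball (x + t • (y - x)) r ⊆ D := fun z hz => by
  set u := z - (x + t • (y - x)) with hu
  have hur : ‖u‖ < r := mem_ball_iff_norm.1 hz
  have := hconv.add_smul_sub_mem (hx (show x + u ∈ _ by simpa [mem_ball_iff_norm] using hur))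
    (hy (show y + u ∈ _ by simpa [mem_ball_iff_norm] using hur)) ht
  convert this using 1
  rw [hu, add_sub_add_right_eq_sub]
  abel

theorem IsPiecewiseC1Curve.kobayashiEDist_le {D : Set (EuclideanSpace ℂ (Fin n))}
    {x y : EuclideanSpace ℂ (Fin n)} {γ : ℝ → EuclideanSpace ℂ (Fin n)}
    (h : IsPiecewiseC1Curve D x y γ) :
    kobayashiEDist D x y ≤ ∫⁻ t in Icc (0 : ℝ) 1, kobayashiMetric D (γ t) (deriv γ t) :=
  sInf_le ⟨γ, h, rfl⟩

theorem kobayashiEDist_le_of_ball_subset {D : Set (EuclideanSpace ℂ (Fin n))}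
    (hconv : Convex ℝ D) {x y : EuclideanSpace ℂ (Fin n)} {r : ℝ} (hr : 0 < r)
    (hx : Metric.ball x r ⊆ D) (hy : Metric.ball y r ⊆ D) :
    kobayashiEDist D x y ≤ ENNReal.ofReal (‖y - x‖ / r) := by
  refine (isPiecewiseC1Curve_lineMap hconv (hx (Metric.mem_ball_self hr))
    (hy (Metric.mem_ball_self hr))).kobayashiEDist_le.trans ?_
  calc ∫⁻ t in Icc (0 : ℝ) 1, kobayashiMetric D (x + t • (y - x))
        (deriv (fun t : ℝ => x + t • (y - x)) t)
      ≤ ∫⁻ _ in Icc (0 : ℝ) 1, ENNReal.ofReal (‖y - x‖ / r) := by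
        refine setLIntegral_mono measurable_const fun t ht => ?_
        have hd : HasDerivAt (fun t : ℝ => x + t • (y - x)) (y - x) t := by
          simpa using ((hasDerivAt_id t).smul_const (y - x)).const_add x
        rw [hd.deriv]
        exact kobayashiMetric_le hr (ball_subset_of_mem_segment hconv hx hy ht) _
    _ = ENNReal.ofReal (‖y - x‖ / r) := by simp

theorem kobayashiEDist_ne_top {D : Set (EuclideanSpace ℂ (Fin n))} (hopen : IsOpen D)
    (hconv : Convex ℝ D) {x y : EuclideanSpace ℂ (Fin n)} (hx : x ∈ D) (hy : y ∈ D) :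
    kobayashiEDist D x y ≠ ⊤ := by
  obtain ⟨r, hr, hxr⟩ := Metric.isOpen_iff.1 hopen x hx
  obtain ⟨s, hs, hys⟩ := Metric.isOpen_iff.1 hopen y hy
  exact ne_top_of_le_ne_top ENNReal.ofReal_ne_top (kobayashiEDist_le_of_ball_subset hconv
    (lt_min hr hs) ((Metric.ball_subset_ball (min_le_left r s)).trans hxr)
    ((Metric.ball_subset_ball (min_le_right r s)).trans hys))

/-! ### Reversal, concatenation and the axioms of a pseudodistance -/

theorem IsPiecewiseC1Curve.reverse {D : Set (EuclideanSpace ℂ (Fin n))}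
    {x y : EuclideanSpace ℂ (Fin n)} {γ : ℝ → EuclideanSpace ℂ (Fin n)}
    (h : IsPiecewiseC1Curve D x y γ) : IsPiecewiseC1Curve D y x (fun t => γ (1 - t)) where
  mapsTo t ht := h.mapsTo ⟨by linarith [ht.2], by linarith [ht.1]⟩
  source := by simpa using h.target
  target := by simpa using h.source
  continuousOn := h.continuousOn.comp (by fun_prop) fun t ht =>
    ⟨by linarith [ht.2], by linarith [ht.1]⟩
  piecewise := by
    obtain ⟨m, τ, hmono, h0, h1, hd⟩ := h.piecewise
    refine ⟨m, fun i => 1 - τ (m - i), fun i j hij => ?_, by simp [h1], by simp [h0],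
      fun i hi => ?_⟩
    · have := hmono (show m - j ≤ m - i by omega)
      simp only
      linarith
    · have hi' : m - (i + 1) + 1 = m - i := by omega
      have := hd (m - (i + 1)) (by omega)
      rw [hi'] at this
      refine this.comp (contDiff_const.sub contDiff_id).contDiffOn fun t ht => ?_
      exact ⟨by linarith [ht.2], by linarith [ht.1]⟩

theorem kobayashiEDist_comm_le (D : Set (EuclideanSpace ℂ (Fin n)))
    (x y : EuclideanSpace ℂ (Fin n)) : kobayashiEDist D y x ≤ kobayashiEDist D x y := by
  refine le_sInf ?_
  rintro _ ⟨γ, hγ, rfl⟩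
  refine hγ.reverse.kobayashiEDist_le.trans ?_
  set f : ℝ → ENNReal := fun t => kobayashiMetric D (γ t) (deriv γ t) with hf
  calc ∫⁻ t in Icc (0 : ℝ) 1, kobayashiMetric D (γ (1 - t)) (deriv (fun t => γ (1 - t)) t)
      ≤ ∫⁻ t in Icc (0 : ℝ) 1, f (1 - t) := by
        refine lintegral_mono fun t => ?_
        simp only [deriv_comp_const_sub]
        have := kobayashiMetric_smul_le D (γ (1 - t)) (deriv γ (1 - t)) (neg_ne_zero.2 one_ne_zero)
        rw [neg_smul, one_smul] at this
        simpa using this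
    _ = ∫⁻ t in (fun t => 1 - t) ⁻¹' Icc (0 : ℝ) 1, f (1 - t) := by simp
    _ = ∫⁻ t in Icc (0 : ℝ) 1, f t :=
        (Measure.measurePreserving_sub_left volume (1 : ℝ)).setLIntegral_comp_preimage_emb
          (MeasurableEquiv.subLeft (1 : ℝ)).measurableEmbedding f _

theorem kobayashiEDist_comm (D : Set (EuclideanSpace ℂ (Fin n)))
    (x y : EuclideanSpace ℂ (Fin n)) : kobayashiEDist D x y = kobayashiEDist D y x :=
  le_antisymm (kobayashiEDist_comm_le D y x) (kobayashiEDist_comm_le D x y)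

/-- The factor `2` cancels the Jacobian. The cases `b = 0` and `b = 1` serve the two halves of a
concatenation. -/
theorem lintegral_comp_two_mul_sub (f : ℝ → ENNReal) (b : ℝ) (s : Set ℝ) :
    ∫⁻ t in (fun t => 2 * t - b) ⁻¹' s, 2 * f (2 * t - b) = ∫⁻ t in s, f t := by
  have h2 : (2 : ℝ) ≠ 0 := two_ne_zero
  set e : ℝ ≃ᵐ ℝ := (MeasurableEquiv.mulLeft₀ (2 : ℝ) h2).trans (MeasurableEquiv.subRight b) with he
  have hmap : Measure.map e volume = ENNReal.ofReal |(2 : ℝ)⁻¹| • volume := by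
    have h1 : (e : ℝ → ℝ) = (fun t => t - b) ∘ fun t => 2 * t := rfl
    rw [h1, ← Measure.map_map (by fun_prop) (by fun_prop), Real.map_volume_mul_left h2,
      Measure.map_smul, (measurePreserving_sub_right volume b).map_eq]
  rw [lintegral_const_mul' _ _ (by simp)]
  have : ∫⁻ t in (fun t => 2 * t - b) ⁻¹' s, f (2 * t - b) = ∫⁻ t in e ⁻¹' s, f (e t) := rfl
  rw [this, ← e.measurableEmbedding.lintegral_map, ← e.measurableEmbedding.restrict_map,
    hmap, Measure.restrict_smul, lintegral_smul_measure, smul_eq_mul, ← mul_assoc]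
  have : (2 : ENNReal) * ENNReal.ofReal |(2 : ℝ)⁻¹| = 1 := by
    rw [abs_of_pos (by positivity), ENNReal.ofReal_inv_of_pos two_pos]
    simp [ENNReal.mul_inv_cancel]
  rw [this, one_mul]

/-- The concatenation of two curves, each run through at twice its speed. -/
noncomputable def concat (γ₁ γ₂ : ℝ → EuclideanSpace ℂ (Fin n)) (t : ℝ) :
    EuclideanSpace ℂ (Fin n) :=
  if t ≤ 1 / 2 then γ₁ (2 * t) else γ₂ (2 * t - 1)

theorem concat_eq_left (γ₁ γ₂ : ℝ → EuclideanSpace ℂ (Fin n)) {t : ℝ} (ht : t ≤ 1 / 2) :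
    concat γ₁ γ₂ t = γ₁ (2 * t) := if_pos ht

theorem concat_eq_right {γ₁ γ₂ : ℝ → EuclideanSpace ℂ (Fin n)} (h : γ₁ 1 = γ₂ 0) {t : ℝ}
    (ht : 1 / 2 ≤ t) : concat γ₁ γ₂ t = γ₂ (2 * t - 1) := by
  rcases ht.eq_or_lt with rfl | ht
  · rw [concat_eq_left _ _ le_rfl]
    norm_num [h]
  · exact if_neg (not_le.2 ht)

theorem IsPiecewiseC1Curve.concat {D : Set (EuclideanSpace ℂ (Fin n))}
    {x y z : EuclideanSpace ℂ (Fin n)} {γ₁ γ₂ : ℝ → EuclideanSpace ℂ (Fin n)}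
    (h₁ : IsPiecewiseC1Curve D x y γ₁) (h₂ : IsPiecewiseC1Curve D y z γ₂) :
    IsPiecewiseC1Curve D x z (concat γ₁ γ₂) := by
  have hmid : γ₁ 1 = γ₂ 0 := h₁.target.trans h₂.source.symm
  have hmem₁ : ∀ t ∈ Icc (0 : ℝ) (1 / 2), 2 * t ∈ Icc (0 : ℝ) 1 := fun t ht =>
    ⟨by linarith [ht.1], by linarith [ht.2]⟩
  have hmem₂ : ∀ t ∈ Icc (1 / 2 : ℝ) 1, 2 * t - 1 ∈ Icc (0 : ℝ) 1 := fun t ht =>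
    ⟨by linarith [ht.1], by linarith [ht.2]⟩
  refine ⟨fun t ht => ?_, ?_, ?_, ?_, ?_⟩
  · rcases le_total t (1 / 2) with h | h
    · rw [concat_eq_left _ _ h]
      exact h₁.mapsTo (hmem₁ t ⟨ht.1, h⟩)
    · rw [concat_eq_right hmid h]
      exact h₂.mapsTo (hmem₂ t ⟨h, ht.2⟩)
  · rw [concat_eq_left _ _ (by norm_num), mul_zero, h₁.source]
  · rw [concat_eq_right hmid (by norm_num)]
    norm_num [h₂.target]
  · rw [← Icc_union_Icc_eq_Icc (show (0 : ℝ) ≤ 1 / 2 by norm_num) (by norm_num)]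
    refine ContinuousOn.union_of_isClosed ?_ ?_ isClosed_Icc isClosed_Icc
    · exact (h₁.continuousOn.comp (by fun_prop) hmem₁).congr fun t ht => concat_eq_left _ _ ht.2
    · exact (h₂.continuousOn.comp (by fun_prop) hmem₂).congr fun t ht => concat_eq_right hmid ht.1
  · obtain ⟨m₁, τ₁, hm₁, ha₁, hb₁, hd₁⟩ := h₁.piecewise
    obtain ⟨m₂, τ₂, hm₂, ha₂, hb₂, hd₂⟩ := h₂.piecewise
    -- Both partitions are halved and the second is shifted. At `i = m₁` both formulas give `1 / 2`,
    -- so either may be used there.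
    set τ : ℕ → ℝ := fun i => if i ≤ m₁ then τ₁ i / 2 else 1 / 2 + τ₂ (i - m₁) / 2 with hτ
    have hl : ∀ i ≤ m₁, τ i = τ₁ i / 2 := fun i hi => if_pos hi
    have hr : ∀ i, m₁ ≤ i → τ i = 1 / 2 + τ₂ (i - m₁) / 2 := fun i hi => by
      rcases hi.eq_or_lt with rfl | hi
      · rw [hl _ le_rfl, hb₁, Nat.sub_self, ha₂]
        norm_num
      · exact if_neg (not_le.2 hi)
    refine ⟨m₁ + m₂, τ, monotone_nat_of_le_succ fun i => ?_, ?_, ?_, fun i hi => ?_⟩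
    · rcases Nat.lt_or_ge i m₁ with h | h
      · rw [hl _ h.le, hl _ h]
        linarith [hm₁ i.le_succ]
      · rw [hr _ h, hr _ (h.trans i.le_succ)]
        linarith [hm₂ (show i - m₁ ≤ i + 1 - m₁ by omega)]
    · rw [hl _ (Nat.zero_le _), ha₁, zero_div]
    · rw [hr _ (Nat.le_add_right _ _), Nat.add_sub_cancel_left, hb₂]
      norm_num
    · rcases Nat.lt_or_ge i m₁ with h | h
      · have hle : τ (i + 1) ≤ 1 / 2 := by
          rw [hl _ h]
          linarith [hm₁ (show i + 1 ≤ m₁ from h)]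
        refine ContDiffOn.congr ?_ fun t ht => concat_eq_left γ₁ γ₂ (ht.2.trans hle)
        refine (hd₁ i h).comp (contDiff_const.mul contDiff_id).contDiffOn fun t ht => ?_
        rw [hl _ h.le, hl _ h] at ht
        exact ⟨by linarith [ht.1], by linarith [ht.2]⟩
      · have hle : 1 / 2 ≤ τ i := by
          rw [hr _ h]
          linarith [hm₂ (Nat.zero_le (i - m₁))]
        refine ContDiffOn.congr ?_ fun t ht => concat_eq_right hmid (hle.trans ht.1)
        refine (hd₂ (i - m₁) (by omega)).comp
          ((contDiff_const.mul contDiff_id).sub contDiff_const).contDiffOn fun t ht => ?_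
        rw [hr _ h, hr (i + 1) (h.trans i.le_succ), Nat.sub_add_comm h] at ht
        exact ⟨by linarith [ht.1], by linarith [ht.2]⟩

theorem kobayashiMetric_deriv_comp_two_mul_sub_le (D : Set (EuclideanSpace ℂ (Fin n)))
    (γ : ℝ → EuclideanSpace ℂ (Fin n)) (b t : ℝ) :
    kobayashiMetric D (γ (2 * t - b)) (deriv (fun s => γ (2 * s - b)) t) ≤
      2 * kobayashiMetric D (γ (2 * t - b)) (deriv γ (2 * t - b)) := by
  have h : deriv (fun s => γ (2 * s - b)) t = (2 : ℝ) • deriv γ (2 * t - b) := by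
    rw [deriv_comp_mul_left (2 : ℝ) (fun s => γ (s - b)) t, deriv_comp_sub_const]
  rw [h]
  refine (kobayashiMetric_smul_le D _ _ two_ne_zero).trans_eq ?_
  rw [← ofReal_norm]
  simp

theorem lintegral_kobayashiMetric_concat_le {D : Set (EuclideanSpace ℂ (Fin n))}
    {γ₁ γ₂ : ℝ → EuclideanSpace ℂ (Fin n)} (h : γ₁ 1 = γ₂ 0) :
    ∫⁻ t in Icc (0 : ℝ) 1, kobayashiMetric D (concat γ₁ γ₂ t) (deriv (concat γ₁ γ₂) t) ≤
      (∫⁻ t in Icc (0 : ℝ) 1, kobayashiMetric D (γ₁ t) (deriv γ₁ t)) +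
        ∫⁻ t in Icc (0 : ℝ) 1, kobayashiMetric D (γ₂ t) (deriv γ₂ t) := by
  set f := fun t => kobayashiMetric D (concat γ₁ γ₂ t) (deriv (concat γ₁ γ₂) t) with hf
  have hl : ∫⁻ t in Icc (0 : ℝ) (1 / 2), f t ≤
      ∫⁻ t in Icc (0 : ℝ) 1, kobayashiMetric D (γ₁ t) (deriv γ₁ t) := by
    -- The joint `1 / 2` is removed since the derivative there is not controlled; elsewhere one
    -- formula holds in a whole neighbourhood.
    rw [setLIntegral_congr (Ico_ae_eq_Icc (a := (0 : ℝ)) (b := 1 / 2)).symm,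
      setLIntegral_congr (Ico_ae_eq_Icc (a := (0 : ℝ)) (b := 1)).symm,
      ← lintegral_comp_two_mul_sub (fun t => kobayashiMetric D (γ₁ t) (deriv γ₁ t)) 0]
    have hpre : (fun t : ℝ => 2 * t - 0) ⁻¹' Ico 0 1 = Ico 0 (1 / 2) := by
      ext t
      simp only [mem_preimage, mem_Ico]
      constructor <;> rintro ⟨h1, h2⟩ <;> constructor <;> linarith
    rw [hpre]
    refine setLIntegral_mono' measurableSet_Ico fun t ht => ?_
    have heq : concat γ₁ γ₂ =ᶠ[𝓝 t] fun s => γ₁ (2 * s - 0) := by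
      filter_upwards [Iio_mem_nhds ht.2] with s hs
      rw [concat_eq_left _ _ (le_of_lt hs), sub_zero]
    rw [hf]
    simp only
    rw [heq.deriv_eq, heq.eq_of_nhds]
    exact kobayashiMetric_deriv_comp_two_mul_sub_le D γ₁ 0 t
  have hr : ∫⁻ t in Ioc (1 / 2 : ℝ) 1, f t ≤
      ∫⁻ t in Icc (0 : ℝ) 1, kobayashiMetric D (γ₂ t) (deriv γ₂ t) := by
    rw [setLIntegral_congr (Ioc_ae_eq_Icc (a := (0 : ℝ)) (b := 1)).symm,
      ← lintegral_comp_two_mul_sub (fun t => kobayashiMetric D (γ₂ t) (deriv γ₂ t)) 1]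
    have hpre : (fun t : ℝ => 2 * t - 1) ⁻¹' Ioc 0 1 = Ioc (1 / 2) 1 := by
      ext t
      simp only [mem_preimage, mem_Ioc]
      constructor <;> rintro ⟨h1, h2⟩ <;> constructor <;> linarith
    rw [hpre]
    refine setLIntegral_mono' measurableSet_Ioc fun t ht => ?_
    have heq : concat γ₁ γ₂ =ᶠ[𝓝 t] fun s => γ₂ (2 * s - 1) := by
      filter_upwards [Ioi_mem_nhds ht.1] with s hs
      exact concat_eq_right h (le_of_lt hs)
    rw [hf]
    simp only
    rw [heq.deriv_eq, heq.eq_of_nhds]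
    exact kobayashiMetric_deriv_comp_two_mul_sub_le D γ₂ 1 t
  calc ∫⁻ t in Icc (0 : ℝ) 1, f t = ∫⁻ t in Icc (0 : ℝ) (1 / 2) ∪ Ioc (1 / 2) 1, f t := by
        rw [Icc_union_Ioc_eq_Icc (by norm_num) (by norm_num)]
    _ ≤ _ := (lintegral_union_le _ _ _).trans (add_le_add hl hr)

theorem kobayashiEDist_triangle (D : Set (EuclideanSpace ℂ (Fin n)))
    (x y z : EuclideanSpace ℂ (Fin n)) :
    kobayashiEDist D x z ≤ kobayashiEDist D x y + kobayashiEDist D y z := by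
  rw [kobayashiEDist.eq_def D x y, ENNReal.sInf_add]
  refine le_iInf₂ ?_
  rintro _ ⟨γ₁, h₁, rfl⟩
  rw [kobayashiEDist.eq_def D y z, ENNReal.add_sInf]
  refine le_iInf₂ ?_
  rintro _ ⟨γ₂, h₂, rfl⟩
  exact (h₁.concat h₂).kobayashiEDist_le.trans
    (lintegral_kobayashiMetric_concat_le (h₁.target.trans h₂.source.symm))

theorem kobayashiDist_comm (D : Set (EuclideanSpace ℂ (Fin n))) (x y : EuclideanSpace ℂ (Fin n)) :
    kobayashiDist D x y = kobayashiDist D y x := by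
  rw [kobayashiDist, kobayashiEDist_comm, kobayashiDist]

theorem kobayashiDist_triangle {D : Set (EuclideanSpace ℂ (Fin n))} (hopen : IsOpen D)
    (hconv : Convex ℝ D) {x y z : EuclideanSpace ℂ (Fin n)} (hx : x ∈ D) (hy : y ∈ D)
    (hz : z ∈ D) : kobayashiDist D x z ≤ kobayashiDist D x y + kobayashiDist D y z := by
  have h1 := kobayashiEDist_ne_top hopen hconv hx hy
  have h2 := kobayashiEDist_ne_top hopen hconv hy hz
  rw [kobayashiDist, kobayashiDist, kobayashiDist, ← ENNReal.toReal_add h1 h2]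
  exact ENNReal.toReal_mono (ENNReal.add_ne_top.2 ⟨h1, h2⟩) (kobayashiEDist_triangle D x y z)

theorem le_kobayashiDist {D : Set (EuclideanSpace ℂ (Fin n))} (hopen : IsOpen D)
    (hconv : Convex ℝ D) {x y : EuclideanSpace ℂ (Fin n)} (hx : x ∈ D) (hy : y ∈ D) {r : ℝ}
    (h : ENNReal.ofReal r ≤ kobayashiEDist D x y) : r ≤ kobayashiDist D x y :=
  (ENNReal.ofReal_le_iff_le_toReal (kobayashiEDist_ne_top hopen hconv hx hy)).1 h

theorem dist_le_mul_kobayashiDist {D : Set (EuclideanSpace ℂ (Fin n))} (hopen : IsOpen D)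
    (hconv : Convex ℝ D) {R : ℝ} (hR : 0 < R) (hD : ∀ x ∈ D, ∀ y ∈ D, dist x y ≤ R)
    {x y : EuclideanSpace ℂ (Fin n)} (hx : x ∈ D) (hy : y ∈ D) :
    dist x y ≤ R * kobayashiDist D x y := by
  have h := ENNReal.toReal_mono (ENNReal.mul_ne_top ENNReal.ofReal_ne_top
    (kobayashiEDist_ne_top hopen hconv hx hy)) (enorm_sub_le_kobayashiEDist hR hD x y)
  rw [ENNReal.toReal_mul, ENNReal.toReal_ofReal hR.le, toReal_enorm] at h
  rwa [dist_comm, dist_eq_norm]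

theorem kobayashiDist_le_of_ball_subset {D : Set (EuclideanSpace ℂ (Fin n))}
    (hconv : Convex ℝ D) {x y : EuclideanSpace ℂ (Fin n)} {r : ℝ} (hr : 0 < r)
    (hx : Metric.ball x r ⊆ D) (hy : Metric.ball y r ⊆ D) :
    kobayashiDist D x y ≤ dist x y / r := by
  rw [dist_comm, dist_eq_norm]
  exact ENNReal.toReal_le_of_le_ofReal (by positivity)
    (kobayashiEDist_le_of_ball_subset hconv hr hx hy)

/-! ### Distance to the boundary and the log-estimate -/

theorem boundaryDist_pos {D : Set (EuclideanSpace ℂ (Fin n))} (hopen : IsOpen D)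
    (hDc : Dᶜ.Nonempty) {z : EuclideanSpace ℂ (Fin n)} (hz : z ∈ D) : 0 < boundaryDist D z :=
  (hopen.isClosed_compl.notMem_iff_infDist_pos hDc).1 (not_not.2 hz)

theorem exists_isSupportVector_nearest {D : Set (EuclideanSpace ℂ (Fin n))} (hne : D.Nonempty)
    (hopen : IsOpen D) (hconv : Convex ℝ D) (hDc : Dᶜ.Nonempty) (x : EuclideanSpace ℂ (Fin n)) :
    ∃ w v, IsSupportVector D w v ∧ dist x w = boundaryDist D x ∧
      ‖inner ℂ v (w - x)‖ ≤ boundaryDist D x := by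
  obtain ⟨w, hw, hd⟩ := hopen.isClosed_compl.exists_infDist_eq_dist hDc x
  obtain ⟨v, hv⟩ := exists_isSupportVector hne hopen hconv hw
  refine ⟨w, v, hv, hd.symm, (hv.norm_inner_le x).trans_eq ?_⟩
  rw [boundaryDist, hd, dist_comm, dist_eq_norm]

/-- For the functional at a point nearest to `y`, `|ℓ(y)| ≤ δ_D(y)` while `|ℓ(x)| ≥ δ_D(x)`. Hence
the boundary is infinitely far away, which gives completeness. -/
theorem half_log_sub_log_le_kobayashiDist {D : Set (EuclideanSpace ℂ (Fin n))}
    (hopen : IsOpen D) (hconv : Convex ℝ D) (hDc : Dᶜ.Nonempty)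
    {x y : EuclideanSpace ℂ (Fin n)} (hx : x ∈ D) (hy : y ∈ D) :
    1 / 2 * (Real.log (boundaryDist D x) - Real.log (boundaryDist D y)) ≤ kobayashiDist D x y := by
  obtain ⟨w, v, hv, -, hle⟩ := exists_isSupportVector_nearest ⟨x, hx⟩ hopen hconv hDc y
  have h := le_kobayashiDist hopen hconv hx hy (hv.abs_log_sub_le_kobayashiEDist hopen x y)
  have hδ := boundaryDist_pos hopen hDc hx
  have h1 := Real.log_le_log hδ
    ((hv.le_re_inner hδ Metric.ball_infDist_compl_subset).trans (Complex.re_le_norm _))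
  have h2 := Real.log_le_log ((hv.re_inner_pos hopen hy).trans_le (Complex.re_le_norm _)) hle
  have h3 := neg_le_abs (Real.log ‖inner ℂ v (w - y)‖ - Real.log ‖inner ℂ v (w - x)‖)
  linarith

theorem isCompact_setOf_isSupportVector (D : Set (EuclideanSpace ℂ (Fin n)))
    (p : EuclideanSpace ℂ (Fin n)) :
    IsCompact {x : EuclideanSpace ℂ (Fin n) × EuclideanSpace ℂ (Fin n) |
      IsSupportVector D x.1 x.2 ∧ dist x.1 p ≤ 1} := by
  refine ((isCompact_closedBall p 1).prod (isCompact_closedBall 0 1)).of_isClosed_subset ?_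
    fun x hx => ⟨hx.2, by simp [hx.1.1]⟩
  have : {x : EuclideanSpace ℂ (Fin n) × EuclideanSpace ℂ (Fin n) |
      IsSupportVector D x.1 x.2 ∧ dist x.1 p ≤ 1} =
      ({x | ‖x.2‖ = 1} ∩ ⋂ z ∈ D, {x | 0 ≤ (inner ℂ x.2 (x.1 - z)).re}) ∩ {x | dist x.1 p ≤ 1} := by
    ext x
    simp [IsSupportVector]
  rw [this]
  refine ((isClosed_eq (by fun_prop) continuous_const).inter (isClosed_biInter fun z _ =>
    isClosed_le continuous_const ?_)).inter (isClosed_le (by fun_prop) continuous_const)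
  exact Complex.continuous_re.comp (continuous_snd.inner (continuous_fst.sub continuous_const))

/-- If no supporting functionals at `p` and `q` have a common zero in the closure of `D`, then the
supporting functionals at points near `p` and `q` have uniformly no common small values. -/
theorem exists_pos_le_norm_inner_or {D : Set (EuclideanSpace ℂ (Fin n))}
    (hbdd : Bornology.IsBounded D) {p q : EuclideanSpace ℂ (Fin n)}
    (hsep : ∀ v v', IsSupportVector D p v → IsSupportVector D q v' → ∀ z ∈ closure D,
      inner ℂ v (p - z) = 0 → inner ℂ v' (q - z) ≠ 0) :
    ∃ c > 0, ∀ w v w' v', IsSupportVector D w v → IsSupportVector D w' v' → dist w p < c →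
      dist w' q < c → ∀ z ∈ D, c ≤ ‖inner ℂ v (w - z)‖ ∨ c ≤ ‖inner ℂ v' (w' - z)‖ := by
  set K := ({x : EuclideanSpace ℂ (Fin n) × EuclideanSpace ℂ (Fin n) |
      IsSupportVector D x.1 x.2 ∧ dist x.1 p ≤ 1} ×ˢ
    {x : EuclideanSpace ℂ (Fin n) × EuclideanSpace ℂ (Fin n) |
      IsSupportVector D x.1 x.2 ∧ dist x.1 q ≤ 1}) ×ˢ closure D with hK
  have hKc : IsCompact K := ((isCompact_setOf_isSupportVector D p).prod
    (isCompact_setOf_isSupportVector D q)).prod hbdd.isCompact_closure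
  -- A zero of `f` on `K` would be a common zero of supporting functionals at `p` and `q`
  -- themselves, so `f` has a positive lower bound on `K`.
  set f := fun x : ((EuclideanSpace ℂ (Fin n) × EuclideanSpace ℂ (Fin n)) ×
      (EuclideanSpace ℂ (Fin n) × EuclideanSpace ℂ (Fin n))) × EuclideanSpace ℂ (Fin n) =>
    max (max (dist x.1.1.1 p) (dist x.1.2.1 q))
      (max ‖inner ℂ x.1.1.2 (x.1.1.1 - x.2)‖ ‖inner ℂ x.1.2.2 (x.1.2.1 - x.2)‖) with hf
  have hfc : Continuous f := by fun_prop
  obtain ⟨c, hc, hcK⟩ := hKc.exists_forall_le' hfc.continuousOn (a := 0) (by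
    rintro ⟨⟨⟨w, v⟩, w', v'⟩, z⟩ ⟨⟨⟨hv, -⟩, hv', -⟩, hz⟩
    by_contra! hle
    simp only [hf, max_le_iff, dist_le_zero, norm_le_zero_iff] at hle hv hv'
    obtain ⟨⟨rfl, rfl⟩, h1, h2⟩ := hle
    exact hsep v v' hv hv' z hz h1 h2)
  refine ⟨min c 1, lt_min hc one_pos, fun w v w' v' hv hv' hw hw' z hz => ?_⟩
  rw [lt_min_iff] at hw hw'
  have := hcK ((((w, v), (w', v')), z)) ⟨⟨⟨hv, hw.2.le⟩, hv', hw'.2.le⟩, subset_closure hz⟩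
  simp only [hf, le_max_iff] at this
  rcases this with (h | h) | h | h
  · exact absurd h (not_le.2 hw.1)
  · exact absurd h (not_le.2 hw'.1)
  · exact Or.inl ((min_le_left _ _).trans h)
  · exact Or.inr ((min_le_left _ _).trans h)

theorem limsup_coe_lt_top_iff {α : Type*} {l : Filter α} {f : α → ℝ} :
    limsup (fun x => ((f x : ℝ) : EReal)) l < ⊤ ↔ ∃ C : ℝ, ∀ᶠ x in l, f x ≤ C := by
  constructor
  · intro h
    obtain ⟨C, hC, -⟩ := EReal.lt_iff_exists_real_btwn.1 h
    exact ⟨C, (eventually_lt_of_limsup_lt hC).mono fun x hx => (EReal.coe_lt_coe_iff.1 hx).le⟩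
  · rintro ⟨C, hC⟩
    exact (limsup_le_of_le (by isBoundedDefault)
      (hC.mono fun x hx => EReal.coe_le_coe_iff.2 hx)).trans_lt (EReal.coe_lt_top C)

theorem logEstimate_iff {D : Set (EuclideanSpace ℂ (Fin n))} {p q : EuclideanSpace ℂ (Fin n)} :
    LogEstimate D p q ↔ ∃ C : ℝ, ∀ᶠ z in 𝓝[D] p ×ˢ 𝓝[D] q,
      -(1 / 2) * Real.log (boundaryDist D z.1) - 1 / 2 * Real.log (boundaryDist D z.2) -
        kobayashiDist D z.1 z.2 ≤ C := by
  rw [LogEstimate, limsup_coe_lt_top_iff]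
  simp only [one_div, Real.log_inv, mul_neg, neg_mul, sub_eq_add_neg]

theorem eventually_mem_ball_and_mem (D : Set (EuclideanSpace ℂ (Fin n)))
    (p : EuclideanSpace ℂ (Fin n)) {ε : ℝ} (hε : 0 < ε) :
    ∀ᶠ x in 𝓝[D] p, dist x p < ε ∧ x ∈ D :=
  (eventually_nhdsWithin_of_eventually_nhds (Metric.ball_mem_nhds p hε)).and
    eventually_mem_nhdsWithin

theorem notMem_of_mem_frontier {D : Set (EuclideanSpace ℂ (Fin n))} (hopen : IsOpen D)
    {p : EuclideanSpace ℂ (Fin n)} (hp : p ∈ frontier D) : p ∉ D :=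
  (hopen.frontier_eq ▸ hp).2

theorem logEstimate_of_separated {D : Set (EuclideanSpace ℂ (Fin n))} (hne : D.Nonempty)
    (hopen : IsOpen D) (hconv : Convex ℝ D) (hbdd : Bornology.IsBounded D)
    {p q : EuclideanSpace ℂ (Fin n)} (hp : p ∈ frontier D) (hq : q ∈ frontier D)
    (hsep : ∀ v v', IsSupportVector D p v → IsSupportVector D q v' → ∀ z ∈ closure D,
      inner ℂ v (p - z) = 0 → inner ℂ v' (q - z) ≠ 0) :
    LogEstimate D p q := by
  have hp' := notMem_of_mem_frontier hopen hp
  have hq' := notMem_of_mem_frontier hopen hq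
  have hDc : Dᶜ.Nonempty := ⟨p, hp'⟩
  obtain ⟨c, hc, hcs⟩ := exists_pos_le_norm_inner_or hbdd hsep
  -- Each of the two costs loses `½ log (1/c)`. Radius `c / 2` suffices below because the nearest
  -- point `w` satisfies `dist w p ≤ 2 * dist x p`.
  refine logEstimate_iff.2 ⟨-Real.log c, ?_⟩
  filter_upwards [(eventually_mem_ball_and_mem D p (half_pos hc)).prod_mk
    (eventually_mem_ball_and_mem D q (half_pos hc))]
  rintro ⟨x, y⟩ ⟨⟨hxp, hx⟩, hyq, hy⟩
  simp only at hxp hx hyq hy ⊢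
  obtain ⟨w, v, hv, hxw, hvx⟩ := exists_isSupportVector_nearest hne hopen hconv hDc x
  obtain ⟨w', v', hv', hyw', hvy⟩ := exists_isSupportVector_nearest hne hopen hconv hDc y
  have hδx : boundaryDist D x ≤ dist x p := Metric.infDist_le_dist_of_mem hp'
  have hδy : boundaryDist D y ≤ dist y q := Metric.infDist_le_dist_of_mem hq'
  have hwp : dist w p < c := by
    linarith [dist_triangle_left w p x]
  have hwq : dist w' q < c := by
    linarith [dist_triangle_left w' q y]
  have key := le_kobayashiDist hopen hconv hx hy (ofReal_log_add_log_le_kobayashiEDist hopen hv hv'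
    hc (hcs w v w' v' hv hv' hwp hwq) hx hy (by linarith) (by linarith))
  have h1 := Real.log_le_log ((hv.re_inner_pos hopen hx).trans_le (Complex.re_le_norm _)) hvx
  have h2 := Real.log_le_log ((hv'.re_inner_pos hopen hy).trans_le (Complex.re_le_norm _)) hvy
  linarith

theorem gromovProductBounded_of_logEstimate {D : Set (EuclideanSpace ℂ (Fin n))}
    (hopen : IsOpen D) (hconv : Convex ℝ D) {p q o : EuclideanSpace ℂ (Fin n)} (ho : o ∈ D)
    (hlog : LogEstimate D p q) (hgrowth : HasLogGrowth D (1 / 2)) :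
    GromovProductBounded D o p q := by
  obtain ⟨C, hC⟩ := logEstimate_iff.1 hlog
  obtain ⟨-, x₀, hx₀, A, hA⟩ := hgrowth
  -- Half of `C`, plus half of `A` and half of the change of base point for each of `x` and `y`.
  refine limsup_coe_lt_top_iff.2 ⟨1 / 2 * C + A + kobayashiDist D x₀ o, ?_⟩
  filter_upwards [hC, (eventually_mem_nhdsWithin (a := p) (s := D)).prod_mk
    (eventually_mem_nhdsWithin (a := q) (s := D))]
  rintro ⟨x, y⟩ h ⟨hx, hy⟩
  simp only at h hx hy
  have h1 := hA (mem_image_of_mem _ hx)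
  have h2 := hA (mem_image_of_mem _ hy)
  simp only [one_div, Real.log_inv] at h1 h2
  have h3 := kobayashiDist_triangle hopen hconv hx hx₀ ho
  have h4 := kobayashiDist_triangle hopen hconv ho hx₀ hy
  rw [kobayashiDist_comm D x x₀] at h3
  rw [kobayashiDist_comm D o x₀] at h4
  rw [gromovProduct]
  linarith

/-! ### Multifaces and zeros of supporting functionals -/

theorem mem_frontier_of_inner_eq_zero {D : Set (EuclideanSpace ℂ (Fin n))} (hopen : IsOpen D)
    {w v z : EuclideanSpace ℂ (Fin n)} (hv : IsSupportVector D w v) (hz : z ∈ closure D)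
    (h : inner ℂ v (w - z) = 0) : z ∈ frontier D := by
  rw [hopen.frontier_eq]
  refine ⟨hz, fun hzD => ?_⟩
  have := hv.re_inner_pos hopen hzD
  simp only [h, Complex.zero_re, lt_self_iff_false] at this

/-- A complex line inside a complex supporting hyperplane produces a complex face. -/
theorem add_smul_mem_multiface {D : Set (EuclideanSpace ℂ (Fin n))} (hopen : IsOpen D)
    {w v a u : EuclideanSpace ℂ (Fin n)} (hv : IsSupportVector D w v) (ha : a ∈ frontier D)
    (hva : inner ℂ v (w - a) = 0) (hu : u ≠ 0) (hvu : inner ℂ v u = 0) {c : ℂ}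
    (hb : a + c • u ∈ frontier D) : a + c • u ∈ multiface D a := by
  set L := AffineSubspace.mk' a (Submodule.span ℂ {u}) with hL
  have haL : a ∈ L := AffineSubspace.self_mem_mk' _ _
  have hbL : a + c • u ∈ L := by
    rw [hL, AffineSubspace.mem_mk', vsub_eq_sub, add_sub_cancel_left]
    exact Submodule.smul_mem _ _ (Submodule.mem_span_singleton_self u)
  refine ⟨L ∩ frontier D, ⟨⟨L, ?_, ?_, ⟨a, haL, ha⟩, rfl⟩, haL, ha⟩, hbL, hb⟩
  · rw [hL, AffineSubspace.direction_mk', finrank_span_singleton hu]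
  · refine eq_empty_of_forall_notMem fun z hz => ?_
    obtain ⟨hzL, hzD⟩ := hz
    rw [SetLike.mem_coe, hL, AffineSubspace.mem_mk', vsub_eq_sub,
      Submodule.mem_span_singleton] at hzL
    obtain ⟨t, ht⟩ := hzL
    have h0 : inner ℂ v (w - z) = 0 := by
      rw [← sub_sub_sub_cancel_right w z a, ← ht, inner_sub_right, hva, inner_smul_right, hvu]
      simp
    have := hv.re_inner_pos hopen hzD
    simp only [h0, Complex.zero_re, lt_self_iff_false] at this

/-- The functional vanishes on the complex line through `a` and `b`. The base point `w` is
arbitrary, so functionals at `p` and at `q` can both be used to produce points of the same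
multiface. -/
theorem mem_multiface_of_inner_eq_zero {D : Set (EuclideanSpace ℂ (Fin n))} (hopen : IsOpen D)
    {w v a b : EuclideanSpace ℂ (Fin n)} (hv : IsSupportVector D w v) (ha : a ∈ closure D)
    (hb : b ∈ closure D) (hva : inner ℂ v (w - a) = 0) (hvb : inner ℂ v (w - b) = 0)
    (hab : a ≠ b) : b ∈ multiface D a := by
  have := add_smul_mem_multiface hopen hv (mem_frontier_of_inner_eq_zero hopen hv ha hva) hva
    (sub_ne_zero.2 hab.symm) (c := 1)
    (by rw [← sub_sub_sub_cancel_left a b w, inner_sub_right, hva, hvb, sub_zero])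
  rw [one_smul, add_sub_cancel] at this
  exact this (mem_frontier_of_inner_eq_zero hopen hv hb hvb)

theorem exists_ne_zero_inner_eq_zero (hn : 2 ≤ n) (v : EuclideanSpace ℂ (Fin n)) :
    ∃ u ≠ 0, inner ℂ v u = 0 := by
  have h1 := Submodule.finrank_add_finrank_orthogonal (Submodule.span ℂ {v})
  have h2 : Module.finrank ℂ (Submodule.span ℂ {v}) ≤ 1 :=
    (finrank_span_le_card {v}).trans_eq (by simp)
  rw [finrank_euclideanSpace_fin] at h1
  have : Nontrivial (Submodule.span ℂ {v})ᗮ := Module.nontrivial_of_finrank_pos (R := ℂ) (by omega)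
  obtain ⟨u, hu⟩ := exists_ne (0 : (Submodule.span ℂ {v})ᗮ)
  exact ⟨u, fun h => hu (Subtype.ext h), Submodule.mem_orthogonal_singleton_iff_inner_right.1 u.2⟩

/-- Dimension at least two matters only for `z = p`, where some complex line through `p` in the zero
set of the functional must be found. -/
theorem mem_multiface_of_two_le (hn : 2 ≤ n) {D : Set (EuclideanSpace ℂ (Fin n))}
    (hopen : IsOpen D) {p v z : EuclideanSpace ℂ (Fin n)} (hv : IsSupportVector D p v)
    (hp : p ∈ closure D) (hz : z ∈ closure D) (h : inner ℂ v (p - z) = 0) :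
    z ∈ multiface D p := by
  rcases eq_or_ne p z with rfl | hpz
  · obtain ⟨u, hu, hvu⟩ := exists_ne_zero_inner_eq_zero hn v
    have hpf := mem_frontier_of_inner_eq_zero hopen hv hp h
    simpa using add_smul_mem_multiface hopen hv hpf h hu hvu (c := 0) (by simpa using hpf)
  · exact mem_multiface_of_inner_eq_zero hopen hv hp hz (by simp) h hpz

theorem eq_zero_of_inner_eq_zero (hn : n < 2) {v u : EuclideanSpace ℂ (Fin n)} (hv : ‖v‖ = 1)
    (h : inner ℂ v u = 0) : u = 0 := by
  by_contra hu
  have h1 := Submodule.finrank_add_finrank_orthogonal (Submodule.span ℂ {v})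
  rw [finrank_euclideanSpace_fin, finrank_span_singleton (by rintro rfl; simp at hv)] at h1
  have h2 : 0 < Module.finrank ℂ (Submodule.span ℂ {v})ᗮ :=
    Module.finrank_pos_iff_exists_ne_zero.2
      ⟨⟨u, Submodule.mem_orthogonal_singleton_iff_inner_right.2 h⟩,
        fun h0 => hu (congrArg Subtype.val h0)⟩
  omega

/-- For `n ≥ 2` a common zero lies in both multifaces. For `n = 1` it equals both `p` and `q`, and
for `n = 0` there is no unit vector. -/
theorem not_common_zero_of_disjoint_multiface {D : Set (EuclideanSpace ℂ (Fin n))}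
    (hopen : IsOpen D) {p q : EuclideanSpace ℂ (Fin n)} (hp : p ∈ frontier D)
    (hq : q ∈ frontier D) (hpq : n = 1 → p ≠ q) (hF : multiface D p ∩ multiface D q = ∅)
    {v v' z : EuclideanSpace ℂ (Fin n)} (hv : IsSupportVector D p v)
    (hv' : IsSupportVector D q v') (hz : z ∈ closure D) (h : inner ℂ v (p - z) = 0) :
    inner ℂ v' (q - z) ≠ 0 := by
  intro h'
  rcases lt_or_ge n 2 with hn | hn
  · have h1 := sub_eq_zero.1 (eq_zero_of_inner_eq_zero hn hv.1 h)
    have h2 := sub_eq_zero.1 (eq_zero_of_inner_eq_zero hn hv'.1 h')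
    have hn1 : n ≠ 1 := fun hn1 => hpq hn1 (h1.trans h2.symm)
    obtain rfl : n = 0 := by omega
    have := hv.1
    rw [Subsingleton.elim v 0, norm_zero] at this
    exact zero_ne_one this
  · exact (hF ▸ ⟨mem_multiface_of_two_le hn hopen hv (frontier_subset_closure hp) hz h,
      mem_multiface_of_two_le hn hopen hv' (frontier_subset_closure hq) hz h'⟩ :
      z ∈ (∅ : Set (EuclideanSpace ℂ (Fin n))))

/-- Triviality of the multiface forces a common zero to be `p`; the functional at `q` then vanishes
at `p` and `q`, which puts `q` in the multiface of `p`. -/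
theorem not_common_zero_of_multiface_subset {D : Set (EuclideanSpace ℂ (Fin n))}
    (hopen : IsOpen D) {p q : EuclideanSpace ℂ (Fin n)} (hp : p ∈ frontier D)
    (hq : q ∈ frontier D) (hqp : q ≠ p) (hF : multiface D p ⊆ {p})
    {v v' z : EuclideanSpace ℂ (Fin n)} (hv : IsSupportVector D p v)
    (hv' : IsSupportVector D q v') (hz : z ∈ closure D) (h : inner ℂ v (p - z) = 0) :
    inner ℂ v' (q - z) ≠ 0 := by
  intro h'
  have hp' := frontier_subset_closure hp
  have hzp : z = p := by
    by_contra hne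
    exact hne (hF (mem_multiface_of_inner_eq_zero hopen hv hp' hz (by simp) h (Ne.symm hne)))
  subst hzp
  exact hqp (hF (mem_multiface_of_inner_eq_zero hopen hv' hz (frontier_subset_closure hq) h'
    (by simp) hqp.symm))

/-! ### Complete hyperbolicity -/

theorem exists_pos_forall_dist_le {D : Set (EuclideanSpace ℂ (Fin n))}
    (hbdd : Bornology.IsBounded D) : ∃ R > 0, ∀ x ∈ D, ∀ y ∈ D, dist x y ≤ R := by
  obtain ⟨R, hR⟩ := Metric.isBounded_iff.1 hbdd
  exact ⟨max R 1, by positivity, fun x hx y hy => (hR hx hy).trans (le_max_left _ _)⟩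

/-- Separates the case `D = univ`, possible only in dimension zero, where `boundaryDist` takes the
default value `0`. -/
theorem compl_nonempty_or_subsingleton {D : Set (EuclideanSpace ℂ (Fin n))}
    (hbdd : Bornology.IsBounded D) :
    Dᶜ.Nonempty ∨ Subsingleton (EuclideanSpace ℂ (Fin n)) := by
  by_contra! h
  obtain ⟨h1, h2⟩ := h
  rw [compl_empty_iff.1 h1] at hbdd
  exact NormedSpace.unbounded_univ ℂ _ hbdd

theorem tendsto_kobayashiDist_of_tendsto {D : Set (EuclideanSpace ℂ (Fin n))}
    (hopen : IsOpen D) (hconv : Convex ℝ D) {u : ℕ → EuclideanSpace ℂ (Fin n)}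
    {z : EuclideanSpace ℂ (Fin n)} (hz : z ∈ D) (hu : Tendsto u atTop (𝓝 z)) :
    Tendsto (fun k => kobayashiDist D (u k) z) atTop (𝓝 0) := by
  obtain ⟨r, hr, hball⟩ := Metric.isOpen_iff.1 hopen z hz
  have hlim : Tendsto (fun k => dist (u k) z / (r / 2)) atTop (𝓝 0) := by
    simpa using (tendsto_iff_dist_tendsto_zero.1 hu).div_const (r / 2)
  refine squeeze_zero' (Eventually.of_forall fun _ => ENNReal.toReal_nonneg) ?_ hlim
  filter_upwards [hu (Metric.ball_mem_nhds z (half_pos hr))] with k hk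
  refine kobayashiDist_le_of_ball_subset hconv (half_pos hr) (fun y hy => hball ?_)
    ((Metric.ball_subset_ball (by linarith)).trans hball)
  have hk' : dist (u k) z < r / 2 := hk
  have hy' : dist y (u k) < r / 2 := hy
  exact Metric.mem_ball.2 (by linarith [dist_triangle y (u k) z])

/-- Cauchy sequences for `k_D` are Cauchy for the Euclidean distance, and
`half_log_sub_log_le_kobayashiDist` keeps them away from the boundary. -/
theorem isCompleteHyperbolic {D : Set (EuclideanSpace ℂ (Fin n))} (hopen : IsOpen D)
    (hconv : Convex ℝ D) (hbdd : Bornology.IsBounded D) : IsCompleteHyperbolic D := by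
  obtain ⟨R, hR, hD⟩ := exists_pos_forall_dist_le hbdd
  have hdist : ∀ {x y}, x ∈ D → y ∈ D → dist x y ≤ R * kobayashiDist D x y := fun hx hy =>
    dist_le_mul_kobayashiDist hopen hconv hR hD hx hy
  refine ⟨fun x hx y hy h => ?_, fun u hu hcau => ?_⟩
  · have := hdist hx hy
    rw [h, mul_zero] at this
    exact dist_le_zero.1 this
  have hcs : CauchySeq u := Metric.cauchySeq_iff.2 fun ε hε => by
    obtain ⟨N, hN⟩ := hcau (ε / R) (by positivity)
    refine ⟨N, fun k hk l hl => (hdist (hu k) (hu l)).trans_lt ?_⟩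
    have := hN k hk l hl
    rwa [lt_div_iff₀ hR, mul_comm] at this
  obtain ⟨z, hz⟩ := cauchySeq_tendsto_of_complete hcs
  suffices hzD : z ∈ D from ⟨z, hzD, tendsto_kobayashiDist_of_tendsto hopen hconv hzD hz⟩
  rcases compl_nonempty_or_subsingleton hbdd with hDc | hsub
  · obtain ⟨N, hN⟩ := hcau 1 one_pos
    have hlow : ∀ᶠ k in atTop, Real.exp (Real.log (boundaryDist D (u N)) - 2) ≤
        boundaryDist D (u k) := by
      filter_upwards [eventually_ge_atTop N] with k hk
      rw [← Real.le_log_iff_exp_le (boundaryDist_pos hopen hDc (hu k))]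
      have h1 := half_log_sub_log_le_kobayashiDist hopen hconv hDc (hu N) (hu k)
      have h2 := hN N le_rfl k hk
      linarith
    have hlim : Tendsto (fun k => boundaryDist D (u k)) atTop (𝓝 (boundaryDist D z)) :=
      ((Metric.continuous_infDist_pt Dᶜ).tendsto z).comp hz
    have hpos := (Real.exp_pos _).trans_le (ge_of_tendsto hlim hlow)
    exact not_not.1 ((hopen.isClosed_compl.notMem_iff_infDist_pos hDc).2 hpos)
  · exact Subsingleton.elim (u 0) z ▸ hu 0

/-! ### Visibility of geodesics -/

/-- A geodesic whose endpoints lie inside and outside the sphere of radius `d` about `p` meets this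
sphere, in a point that lies metrically between the endpoints. -/
theorem IsGeodesic.exists_dist_eq {D : Set (EuclideanSpace ℂ (Fin n))} (hopen : IsOpen D)
    (hconv : Convex ℝ D) (hbdd : Bornology.IsBounded D) {L : ℝ}
    {σ : ℝ → EuclideanSpace ℂ (Fin n)} (hσ : IsGeodesic D L σ) {p : EuclideanSpace ℂ (Fin n)}
    {d : ℝ} (h0 : dist (σ 0) p ≤ d) (hL : d ≤ dist (σ L) p) :
    ∃ t ∈ Icc 0 L, dist (σ t) p = d ∧ kobayashiDist D (σ 0) (σ L) =
      kobayashiDist D (σ 0) (σ t) + kobayashiDist D (σ t) (σ L) := by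
  obtain ⟨hL0, hmaps, hgeo⟩ := hσ
  obtain ⟨R, hR, hD⟩ := exists_pos_forall_dist_le hbdd
  -- Continuity is not part of `IsGeodesic`; it follows because `R * k_D` dominates the Euclidean
  -- distance.
  have hcont : ContinuousOn σ (Icc 0 L) := by
    refine (LipschitzOnWith.of_dist_le_mul (K := ⟨R, hR.le⟩) fun s hs t ht => ?_).continuousOn
    rw [Real.dist_eq, ← hgeo s hs t ht]
    exact dist_le_mul_kobayashiDist hopen hconv hR hD (hmaps hs) (hmaps ht)
  have hdcont : ContinuousOn (fun t => dist (σ t) p) (Icc 0 L) :=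
    (continuous_id.dist continuous_const).comp_continuousOn hcont
  obtain ⟨t, ht, htd⟩ := intermediate_value_Icc hL0 hdcont ⟨h0, hL⟩
  refine ⟨t, ht, htd, ?_⟩
  have h0m : (0 : ℝ) ∈ Icc 0 L := left_mem_Icc.2 hL0
  have hLm : L ∈ Icc 0 L := right_mem_Icc.2 hL0
  rw [hgeo 0 h0m L hLm, hgeo 0 h0m t ht, hgeo t ht L hLm, zero_sub, zero_sub, abs_neg, abs_neg,
    abs_of_nonneg hL0, abs_of_nonneg ht.1, abs_of_nonpos (by linarith [ht.2])]
  ring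

theorem isCompact_setOf_le_boundaryDist {D : Set (EuclideanSpace ℂ (Fin n))}
    (hbdd : Bornology.IsBounded D) {ε : ℝ} (hε : 0 < ε) :
    {z | ε ≤ boundaryDist D z} ⊆ D ∧ IsCompact {z | ε ≤ boundaryDist D z} := by
  have hsub : {z | ε ≤ boundaryDist D z} ⊆ D := fun z hz => by
    by_contra hzD
    have h0 : boundaryDist D z = 0 := Metric.infDist_zero_of_mem hzD
    have hz' : ε ≤ boundaryDist D z := hz
    linarith
  exact ⟨hsub, Metric.isCompact_of_isClosed_isBounded
    (isClosed_le continuous_const (Metric.continuous_infDist_pt Dᶜ)) (hbdd.subset hsub)⟩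

/-- Without visible geodesics at `p, q` there are points metrically between points near `p` and
points near `q` that approach the boundary away from `p` and `q`. -/
theorem exists_between_of_not_hasVisibleGeodesics {D : Set (EuclideanSpace ℂ (Fin n))}
    (hopen : IsOpen D) (hconv : Convex ℝ D) (hbdd : Bornology.IsBounded D)
    {p q : EuclideanSpace ℂ (Fin n)} (hpq : p ≠ q) (h : ¬ HasVisibleGeodesics D p q)
    {ε : ℝ} (hε : 0 < ε) :
    ∃ x y z, x ∈ D ∧ y ∈ D ∧ z ∈ D ∧ dist x p < ε ∧ dist y q < ε ∧ dist z p = dist p q / 2 ∧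
      boundaryDist D z < ε ∧
      kobayashiDist D x y = kobayashiDist D x z + kobayashiDist D z y := by
  have hd : 0 < dist p q := dist_pos.2 hpq
  -- A third of the distance makes the closed balls disjoint and lets the sphere of radius `dist p q
  -- / 2` about `p` separate them.
  set r := min ε (dist p q / 3) with hr
  have hr0 : 0 < r := lt_min hε (by positivity)
  have hrd : r ≤ dist p q / 3 := min_le_right _ _
  have hdisj : closure (Metric.ball p r) ∩ closure (Metric.ball q r) = ∅ := by
    refine eq_empty_of_forall_notMem fun z hz => ?_
    have h1 := Metric.mem_closedBall.1 (Metric.closure_ball_subset_closedBall hz.1)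
    have h2 := Metric.mem_closedBall.1 (Metric.closure_ball_subset_closedBall hz.2)
    linarith [dist_triangle_left p q z]
  obtain ⟨hKD, hK⟩ := isCompact_setOf_le_boundaryDist hbdd hε
  obtain ⟨L, σ, hσ, h0, hL, hmeet⟩ : ∃ L σ, IsGeodesic D L σ ∧ σ 0 ∈ Metric.ball p r ∧
      σ L ∈ Metric.ball q r ∧ ¬ (σ '' Icc 0 L ∩ {z | ε ≤ boundaryDist D z}).Nonempty := by
    by_contra! hcon
    exact h ⟨_, Metric.ball_mem_nhds p hr0, _, Metric.ball_mem_nhds q hr0, hdisj, _, hKD, hK,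
      fun L σ hσ h0 hL => hcon L σ hσ h0 hL⟩
  rw [Metric.mem_ball] at h0 hL
  obtain ⟨t, ht, htd, hk⟩ := hσ.exists_dist_eq hopen hconv hbdd (p := p) (d := dist p q / 2)
    (by linarith) (by linarith [dist_triangle_left p q (σ L)])
  refine ⟨σ 0, σ L, σ t, hσ.2.1 (left_mem_Icc.2 hσ.1), hσ.2.1 (right_mem_Icc.2 hσ.1), hσ.2.1 ht,
    h0.trans_le (min_le_left _ _), hL.trans_le (min_le_left _ _), htd, ?_, hk⟩
  by_contra! hle
  exact hmeet ⟨σ t, mem_image_of_mem σ ht, hle⟩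

theorem hasVisibleGeodesics_of_logEstimate {D : Set (EuclideanSpace ℂ (Fin n))}
    (hopen : IsOpen D) (hconv : Convex ℝ D) (hbdd : Bornology.IsBounded D)
    (hlog : ∀ p ∈ frontier D, ∀ q ∈ frontier D, p ≠ q → LogEstimate D p q)
    (hgrowth : HasLogGrowth D (1 / 2)) {p q : EuclideanSpace ℂ (Fin n)} (hp : p ∈ frontier D)
    (hq : q ∈ frontier D) (hpq : p ≠ q) : HasVisibleGeodesics D p q := by
  by_contra hvis
  have hd : 0 < dist p q := dist_pos.2 hpq
  have hDc : Dᶜ.Nonempty := ⟨p, notMem_of_mem_frontier hopen hp⟩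
  choose x y z hx hy hz hxp hyq hzp hzδ hk using fun k : ℕ =>
    exists_between_of_not_hasVisibleGeodesics hopen hconv hbdd hpq hvis
      (Nat.one_div_pos_of_nat (α := ℝ) (n := k))
  have hlim : Tendsto (fun k : ℕ => 1 / ((k : ℝ) + 1)) atTop (𝓝 0) :=
    tendsto_one_div_add_atTop_nhds_zero_nat
  have hxlim : Tendsto x atTop (𝓝 p) := tendsto_iff_dist_tendsto_zero.2
    (squeeze_zero (fun _ => dist_nonneg) (fun k => (hxp k).le) hlim)
  have hylim : Tendsto y atTop (𝓝 q) := tendsto_iff_dist_tendsto_zero.2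
    (squeeze_zero (fun _ => dist_nonneg) (fun k => (hyq k).le) hlim)
  have hδlim : Tendsto (fun k => boundaryDist D (z k)) atTop (𝓝 0) :=
    squeeze_zero (fun _ => Metric.infDist_nonneg) (fun k => (hzδ k).le) hlim
  obtain ⟨r, hrc, φ, hφ, hzr⟩ := hbdd.isCompact_closure.tendsto_subseq
    fun k => subset_closure (hz k)
  have hφt := hφ.tendsto_atTop
  have hrδ : boundaryDist D r = 0 := tendsto_nhds_unique
    (((Metric.continuous_infDist_pt Dᶜ).tendsto r).comp hzr) (hδlim.comp hφt)
  have hrD : r ∈ frontier D := by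
    rw [hopen.frontier_eq]
    exact ⟨hrc, (hopen.isClosed_compl.mem_iff_infDist_zero hDc).2 hrδ⟩
  have hrp : dist r p = dist p q / 2 := tendsto_nhds_unique (hzr.dist tendsto_const_nhds)
    (tendsto_const_nhds.congr fun k => (hzp (φ k)).symm)
  have hpr : p ≠ r := by
    rintro rfl
    rw [dist_self] at hrp
    linarith
  have hrq : r ≠ q := by
    rintro rfl
    rw [dist_comm] at hrp
    linarith
  obtain ⟨C₁, hC₁⟩ := logEstimate_iff.1 (hlog p hp r hrD hpr)
  obtain ⟨C₂, hC₂⟩ := logEstimate_iff.1 (hlog r hrD q hq hrq)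
  obtain ⟨-, x₀, hx₀, A, hA⟩ := hgrowth
  have tx : Tendsto (x ∘ φ) atTop (𝓝[D] p) := tendsto_nhdsWithin_iff.2
    ⟨hxlim.comp hφt, Eventually.of_forall fun k => hx _⟩
  have ty : Tendsto (y ∘ φ) atTop (𝓝[D] q) := tendsto_nhdsWithin_iff.2
    ⟨hylim.comp hφt, Eventually.of_forall fun k => hy _⟩
  have tz : Tendsto (z ∘ φ) atTop (𝓝[D] r) := tendsto_nhdsWithin_iff.2
    ⟨hzr, Eventually.of_forall fun k => hz _⟩
  -- The two log-estimates and the growth bounds at `x` and `y` together give `log (1/δ_D(z)) ≤ C₁ +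
  -- C₂ + 2A`; this threshold contradicts it.
  have hsmall := (hδlim.comp hφt).eventually
    (gt_mem_nhds (Real.exp_pos (-(C₁ + C₂ + 2 * A))))
  obtain ⟨k, h1, h2, h3⟩ := (((tx.prodMk tz).eventually hC₁).and
    (((tz.prodMk ty).eventually hC₂).and hsmall)).exists
  simp only [Function.comp_apply] at h1 h2 h3
  rw [← Real.log_lt_iff_lt_exp (boundaryDist_pos hopen hDc (hz _))] at h3
  have h4 := hA (mem_image_of_mem _ (hx (φ k)))
  have h5 := hA (mem_image_of_mem _ (hy (φ k)))
  simp only [one_div, Real.log_inv] at h4 h5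
  have h6 := kobayashiDist_triangle hopen hconv (hx (φ k)) hx₀ (hy (φ k))
  rw [kobayashiDist_comm D _ x₀] at h6
  have h7 := hk (φ k)
  linarith

end ConvexVisibility

theorem mainTheorem8 {n : ℕ} (D : Set (EuclideanSpace ℂ (Fin n)))
    (hne : D.Nonempty) (hopen : IsOpen D) (hconv : Convex ℝ D)
    (hbdd : Bornology.IsBounded D) :
    (∀ p ∈ frontier D, ∀ q ∈ frontier D, (n = 1 → p ≠ q) →
      ConvexVisibility.multiface D p ∩ ConvexVisibility.multiface D q = ∅ →
      ConvexVisibility.LogEstimate D p q ∧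
      (ConvexVisibility.HasLogGrowth D (1 / 2) →
        ∀ o ∈ D, ConvexVisibility.GromovProductBounded D o p q)) ∧
    (∀ p ∈ frontier D, ConvexVisibility.multiface D p ⊆ {p} →
      ∀ q ∈ frontier D, q ≠ p → ConvexVisibility.LogEstimate D p q) ∧
    ((∀ p ∈ frontier D, ConvexVisibility.multiface D p ⊆ {p}) →
      ConvexVisibility.HasLogGrowth D (1 / 2) →
      ConvexVisibility.HasVisibilityProperty D) := by
  have htrivial : ∀ p ∈ frontier D, ConvexVisibility.multiface D p ⊆ {p} →
      ∀ q ∈ frontier D, q ≠ p → ConvexVisibility.LogEstimate D p q := fun p hp hF q hq hqp =>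
    ConvexVisibility.logEstimate_of_separated hne hopen hconv hbdd hp hq
      fun _ _ hv hv' _ hz h =>
        ConvexVisibility.not_common_zero_of_multiface_subset hopen hp hq hqp hF hv hv' hz h
  refine ⟨fun p hp q hq hpq hF => ?_, htrivial, fun hF hgrowth =>
    ⟨ConvexVisibility.isCompleteHyperbolic hopen hconv hbdd, fun p hp q hq hpq =>
      ConvexVisibility.hasVisibleGeodesics_of_logEstimate hopen hconv hbdd
        (fun p hp q hq hpq => htrivial p hp (hF p hp) q hq hpq.symm) hgrowth hp hq hpq⟩⟩
  have hlog : ConvexVisibility.LogEstimate D p q :=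
    ConvexVisibility.logEstimate_of_separated hne hopen hconv hbdd hp hq
      fun _ _ hv hv' _ hz h =>
        ConvexVisibility.not_common_zero_of_disjoint_multiface hopen hp hq hpq hF hv hv' hz h
  exact ⟨hlog, fun hgrowth o ho =>
    ConvexVisibility.gromovProductBounded_of_logEstimate hopen hconv ho hlog hgrowth⟩
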